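/- Let $n\ge 1$ and let $R_n=\mathbb{Q}[x_1,\dots,x_n,y_1,\dots,y_n]$. A bicomposition is a finite (possibly empty) sequence $\alpha=\big((a_1,b_1),\dots,(a_k,b_k)\big)$ of pairs of nonnegative integers, none equal to $(0,0)$; put $$M_\alpha=\sum_{1\le i_1<\dots<i_k\le n}x_{i_1}^{a_1}y_{i_1}^{b_1}\cdots x_{i_k}^{a_k}y_{i_k}^{b_k}\in R_n .$$ Let $\mathsf{DQSym}_n$ be the $\mathbb{Q}$-span of all $M_\alpha$ (the diagonally quasi-symmetric polynomials), and let $I_n=\langle \mathsf{DQSym}_n^+\rangle$ be the ideal of $R_n$ generated by the elements of $\mathsf{DQSym}_n$ with zero constant term. For $i,j\ge 0$ let $V_n^{i,j}$ be the image in $R_n/I_n$ of the space of polynomials that are homogeneous of degree $i$ in $x_1,\dots,x_n$ and homogeneous of degree $j$ in $y_1,\dots,y_n$. The Hilbert matrix of $R_n/I_n$ is $M_n(a,b)=\dim_{\mathbb{Q}}V_n^{a-1,b-1}$ for $a,b\ge 1$. Then: 1. if $n\ge 2$, then $M_n(n-1,2)=\dfrac1n\dbinom{2n-2}{n-1}$;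 2. $M_n(i,2)=\displaystyle\sum_{1\le j\le i,\ 1\le k\le 2}M_{n-1}(j,k)$ for $1\le i\le n-2$; 3. $M_n(i,2)=0$ for all $i\ge n$; 4. $M_n(a,b)=M_n(b,a)$ for all $a,b\ge 1$; consequently, if $n\ge 2$, then $M_n(2,n-1)=\dfrac1n\dbinom{2n-2}{n-1}$; moreover $M_n(2,i)=\displaystyle\sum_{1\le j\le i,\ 1\le k\le 2}M_{n-1}(k,j)$ for $1\le i\le n-2$, and $M_n(2,i)=0$ for all $i\ge n$. -/

import Mathlib

namespace DiagQSym

/-- The polynomial ring `R_n = ℚ[x₁,…,xₙ,y₁,…,yₙ]`: the variable `x_i` is `Sum.inl i` and the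
variable `y_i` is `Sum.inr i`. -/
abbrev PolyRing (n : ℕ) : Type := MvPolynomial (Fin n ⊕ Fin n) ℚ

/-- A bicomposition, as the list of its columns: a finite sequence (possibly empty) of pairs of
natural numbers, none of which is `(0, 0)`. -/
def IsBicomposition (α : List (ℕ × ℕ)) : Prop := ∀ c ∈ α, c ≠ (0, 0)

/-- The monomial diagonally quasi-symmetric polynomial
`M_α = ∑_{i₁ < ⋯ < i_k} x_{i₁}^{α₁₁} y_{i₁}^{α₂₁} ⋯ x_{i_k}^{α₁ₖ} y_{i_k}^{α₂ₖ}`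
in `n` pairs of variables, where `k` is the length of `α`. -/
noncomputable def monomialDQSym (n : ℕ) (α : List (ℕ × ℕ)) : PolyRing n :=
  ∑ ι : Fin α.length → Fin n with StrictMono ι,
    ∏ j : Fin α.length,
      (MvPolynomial.X (Sum.inl (ι j)) ^ (α.get j).1 *
        MvPolynomial.X (Sum.inr (ι j)) ^ (α.get j).2)

/-- `DQSym_n`: the space of diagonally quasi-symmetric polynomials in `n` pairs of variables, the
`ℚ`-span of the `M_α` over all bicompositions `α`. -/
noncomputable def DQSym (n : ℕ) : Submodule ℚ (PolyRing n) :=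
  Submodule.span ℚ {f | ∃ α : List (ℕ × ℕ), IsBicomposition α ∧ f = monomialDQSym n α}

/-- The ideal `I_n = ⟨DQSym_n⁺⟩` of `R_n` generated by the diagonally quasi-symmetric polynomials
without constant term. -/
noncomputable def idealDQSym (n : ℕ) : Ideal (PolyRing n) :=
  Ideal.span {f | f ∈ DQSym n ∧ MvPolynomial.constantCoeff f = 0}

/-- `R_n^{i,j}`: the polynomials that are homogeneous of degree `i` in the variables `x` and
of degree `j` in the variables `y`. -/
noncomputable def bihomogeneousPart (n i j : ℕ) : Submodule ℚ (PolyRing n) :=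
  MvPolynomial.weightedHomogeneousSubmodule ℚ
    (Sum.elim (fun _ : Fin n => ((1, 0) : ℕ × ℕ)) (fun _ : Fin n => ((0, 1) : ℕ × ℕ))) (i, j)

/-- `V_n^{i,j}`: the component of bidegree `(i, j)` of the quotient `R_n / I_n`, that is, the image
of `R_n^{i,j}` in the quotient. -/
noncomputable def quotientPart (n i j : ℕ) : Submodule ℚ (PolyRing n ⧸ idealDQSym n) :=
  (bihomogeneousPart n i j).map (Ideal.Quotient.mkₐ ℚ (idealDQSym n)).toLinearMap

/-- The Hilbert matrix `M_n(a, b) = dim V_n^{a-1,b-1}`, with rows and columns indexed by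
`a, b = 1, 2, …` (index `0` is not used). -/
noncomputable def hilbertMatrix (n a b : ℕ) : ℕ :=
  Module.finrank ℚ (quotientPart n (a - 1) (b - 1))

end DiagQSym

/-!
Write `R_n` for the polynomial ring, `I_n` for the ideal, and `s_n(d)`, `w_n(d)` for the dimensions
of `V_n^{d,0}` and `V_n^{d,1}`. All the claims follow from the vanishing of `V_n^{i,j}` for
`i + j ≥ n`, the symmetry exchanging the `x` and the `y`, and the closed forms

`s_n(d) = 2 ((n, d)) - ((n+1, d))` for `d ≤ n`,
`w_n(d) = 2 n ((n, d)) - (n+1) ((n+1, d))` for `d ≤ n - 2`,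

where `((n, d))` is the number of multisets of size `d` in a set of size `n`
(`finrank_quotientPart_zero`, `finrank_quotientPart_one`).

*Lower bound.* A product of two `M_α` is a sum of `M_γ` (quasi-shuffle), so by a graded Nakayama
argument `R_n` is spanned by the products of an `M_α` and a lift of a basis element of `R_n / I_n`.
Counting dimensions gives `multichoose_mul_le_sum`: the Hilbert function of `R_n` is at most the
convolution of the number of bicompositions with the Hilbert function of the quotient. A generating
function computation (`sum_bicompositionCount_mul_dim`) shows that the closed forms turn these
inequalities into equalities. It therefore suffices to bound `s_n` and `w_n` from above by the
closed forms (`eq_of_sum_le`).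

*Upper bound.* Splitting off the first pair of variables gives
`dim V_{n+1}^p ≤ ∑_{q ≤ p} dim V_n^q` (`finrank_quotientPart_succ_le`), and the closed forms satisfy
this recursion with equality. Two facts about the top degrees keep the induction going:
`V_n^{i,j} = 0` for `i + j ≥ n` (`quotientPart_eq_bot`), and `V_n^{n-2,1} = y_n V_n^{n-2,0}`
(`quotientPart_le_map`), which bounds `w_n(n-2)` by `s_n(n-2)`.

*Top degrees.* Both facts come from a rewriting procedure. A word with letters separated by weak or
strict signs stands for the sum of the monomials obtained by placing its letters at weakly or
strictly increasing positions; over all positions, every nonempty word is a sum of `M_γ`, hence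
zero in the quotient. `varProd_mul_tailChain_mem_lexLower` processes the positions of a monomial one
at a time: the block of letters at position `q` is replaced by a longer word over the positions from
`q` on, at the price of lexicographically smaller monomials. If the monomial has at least as many
letters as there are positions, the procedure ends at position `0` with a nonempty word, so every
monomial of degree `n` is a combination of smaller ones, and hence zero.

For a monomial of degree `n - 1` of degree one in the `y`, one letter is missing, and the
procedure is run for the difference of two monomials which place the `y` at two different positions
`j < r` of the same support. To treat both monomials at once, the letters take values in the square
of the quotient ring: the neutral letter is `(x, x)`, and the two special letters are `(x, y)` and
`(y, x)`. If the two special letters meet at the same position, the result lies in the diagonal, and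
`r` can be chosen such that this always occurs. Thus all placements of the `y` on a given
support agree (`varProd_letterPair_mem_diagSubring`), and the `y` can be moved to the last position.
-/

namespace DiagQSym

open MvPolynomial

/-! ### Monomial quasi-symmetric functions and the ideal -/

theorem IsBicomposition.cons {b : ℕ × ℕ} {γ : List (ℕ × ℕ)} (hb : b ≠ (0, 0))
    (hγ : IsBicomposition γ) : IsBicomposition (b :: γ) := by
  intro e he
  rcases List.mem_cons.1 he with rfl | he
  exacts [hb, hγ e he]

section Mono

variable {P R : Type*} [CommRing R]

/-- The sum of `x_{p₁}^{a₁} y_{p₁}^{b₁} ⋯ x_{p_k}^{a_k} y_{p_k}^{b_k}` over the sublists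
`p₁, …, p_k` of a list of positions, where `(a₁, b₁), …, (a_k, b_k)` are the columns of the second
list. The recursion distinguishes whether the first position is used. -/
def qsymSum (x y : P → R) : List P → List (ℕ × ℕ) → R
  | _, [] => 1
  | [], _ :: _ => 0
  | p :: ps, c :: α => x p ^ c.1 * y p ^ c.2 * qsymSum x y ps α + qsymSum x y ps (c :: α)

@[simp] theorem qsymSum_nil (x y : P → R) (ps : List P) : qsymSum x y ps [] = 1 := by
  cases ps <;> rfl

@[simp] theorem qsymSum_nil_cons (x y : P → R) (c : ℕ × ℕ) (α : List (ℕ × ℕ)) :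
    qsymSum x y [] (c :: α) = 0 := rfl

theorem qsymSum_cons_cons (x y : P → R) (p : P) (ps : List P) (c : ℕ × ℕ) (α : List (ℕ × ℕ)) :
    qsymSum x y (p :: ps) (c :: α) =
      x p ^ c.1 * y p ^ c.2 * qsymSum x y ps α + qsymSum x y ps (c :: α) := rfl

theorem qsymSum_map {Q : Type*} (g : Q → P) (x y : P → R) (qs : List Q) (α : List (ℕ × ℕ)) :
    qsymSum x y (qs.map g) α = qsymSum (x ∘ g) (y ∘ g) qs α := by
  induction qs generalizing α with
  | nil => cases α <;> rfl
  | cons q qs ih => cases α <;> simp [qsymSum_cons_cons, ih]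

theorem map_qsymSum {S : Type*} [CommRing S] (f : R →+* S) (x y : P → R) (ps : List P)
    (α : List (ℕ × ℕ)) : f (qsymSum x y ps α) = qsymSum (f ∘ x) (f ∘ y) ps α := by
  induction ps generalizing α with
  | nil => cases α <;> simp
  | cons p ps ih => cases α <;> simp [qsymSum_cons_cons, ih]

/-- Quasi-shuffle product: the list `Γ` of bicompositions does not depend on the positions. -/
theorem exists_qsymSum_mul (x y : P → R) (α β : List (ℕ × ℕ)) (hα : IsBicomposition α)
    (hβ : IsBicomposition β) : ∃ Γ : List (List (ℕ × ℕ)),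
      (∀ γ ∈ Γ, IsBicomposition γ ∧ γ.sum = α.sum + β.sum) ∧
      ∀ ps, qsymSum x y ps α * qsymSum x y ps β = (Γ.map (qsymSum x y ps)).sum := by
  induction α generalizing β with
  | nil => exact ⟨[β], by simpa using hβ, by simp⟩
  | cons c α ihα =>
    have hα' : IsBicomposition α := fun d hd => hα d (List.mem_cons_of_mem _ hd)
    have hc := hα c List.mem_cons_self
    induction β with
    | nil => exact ⟨[c :: α], by simpa using hα, by simp⟩
    | cons d β ihβ =>
      have hβ' : IsBicomposition β := fun d hd => hβ d (List.mem_cons_of_mem _ hd)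
      have hd := hβ d List.mem_cons_self
      obtain ⟨Γ₁, h₁, e₁⟩ := ihα (d :: β) hα' hβ
      obtain ⟨Γ₂, h₂, e₂⟩ := ihβ hβ'
      obtain ⟨Γ₃, h₃, e₃⟩ := ihα β hα' hβ'
      have hcd : c + d ≠ (0, 0) := by
        intro h
        apply hc
        have h1 := congrArg Prod.fst h
        have h2 := congrArg Prod.snd h
        simp only [Prod.fst_add, Prod.snd_add] at h1 h2
        ext <;> simp <;> omega
      refine ⟨Γ₁.map (c :: ·) ++ Γ₂.map (d :: ·) ++ Γ₃.map ((c + d) :: ·), ?_, ?_⟩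
      · intro γ hγ
        simp only [List.mem_append, List.mem_map] at hγ
        rcases hγ with (⟨γ, hγ, rfl⟩ | ⟨γ, hγ, rfl⟩) | ⟨γ, hγ, rfl⟩
        · exact ⟨IsBicomposition.cons hc (h₁ γ hγ).1, by simp [(h₁ γ hγ).2]; abel⟩
        · exact ⟨IsBicomposition.cons hd (h₂ γ hγ).1, by simp [(h₂ γ hγ).2]; abel⟩
        · exact ⟨IsBicomposition.cons hcd (h₃ γ hγ).1, by simp [(h₃ γ hγ).2]; abel⟩
      · intro ps
        induction ps with
        | nil => simp [Function.comp_def]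
        | cons p ps ih =>
          simp only [List.map_append, List.sum_append, List.map_map, Function.comp_def,
            qsymSum_cons_cons, List.sum_map_add, List.sum_map_mul_left, ← e₁, ← e₂, ← e₃] at ih ⊢
          simp only [Prod.fst_add, Prod.snd_add, pow_add]
          linear_combination ih

end Mono

/-- A strictly increasing map either sends its first argument to `0`, or takes values in the
successors only. -/
theorem sum_strictMono_eq_qsymSum {R : Type*} [CommRing R] (n : ℕ) (x y : Fin n → R)
    (α : List (ℕ × ℕ)) :
    ∑ ι : Fin α.length → Fin n with StrictMono ι,
      ∏ j : Fin α.length, (x (ι j) ^ (α.get j).1 * y (ι j) ^ (α.get j).2) =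
    qsymSum x y (List.finRange n) α := by
  induction n generalizing α with
  | zero =>
    cases α with
    | nil => simp [Finset.filter_true_of_mem, Subsingleton.strictMono]
    | cons c α => simp
  | succ n ih =>
    cases α with
    | nil => simp [Finset.filter_true_of_mem, Subsingleton.strictMono]
    | cons c α =>
      have e1 := ih (x ∘ Fin.succ) (y ∘ Fin.succ) α
      have e2 := ih (x ∘ Fin.succ) (y ∘ Fin.succ) (c :: α)
      rw [List.finRange_succ, qsymSum_cons_cons, qsymSum_map, qsymSum_map, ← e1, ← e2,
        ← Finset.sum_filter_add_sum_filter_not _ (fun ι => ι ⟨0, by simp⟩ = 0), Finset.mul_sum]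
      congr 1
      · symm
        refine Finset.sum_nbij (fun κ => (Fin.cons 0 (Fin.succ ∘ κ) :
          Fin (α.length + 1) → Fin (n + 1))) ?_ ?_ ?_ ?_
        · intro κ hκ
          simp only [Finset.mem_filter, Finset.mem_univ, true_and] at hκ ⊢
          refine ⟨?_, rfl⟩
          intro i j hij
          induction i using Fin.cases with
          | zero =>
            induction j using Fin.cases with
            | zero => exact absurd hij (lt_irrefl _)
            | succ j => simp
          | succ i =>
            induction j using Fin.cases with
            | zero => exact absurd hij (by simp)
            | succ j => simpa using hκ (Fin.succ_lt_succ_iff.1 hij)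
        · intro κ _ κ' _ h
          have := Fin.cons_right_injective _ h
          exact (Fin.succ_injective n).comp_left this
        · intro ι hι
          obtain ⟨h1, h2⟩ := Finset.mem_filter.1 (Finset.mem_coe.1 hι)
          have h1 : StrictMono ι := (Finset.mem_filter.1 h1).2
          have h3 : ∀ i : Fin α.length, ι i.succ ≠ 0 := fun i hi => by
            have h4 := h1 (Fin.succ_pos i)
            rw [hi] at h4
            exact absurd h4 (Fin.not_lt_zero _)
          refine ⟨fun i => (ι i.succ).pred (h3 i), ?_, ?_⟩
          · simp only [Finset.coe_filter, Finset.mem_univ, true_and]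
            intro i j hij
            exact Fin.pred_lt_pred_iff.2 (h1 (Fin.succ_lt_succ_iff.2 hij))
          · funext i
            induction i using Fin.cases with
            | zero => exact h2.symm
            | succ i => simp
        · intro κ hκ
          erw [Fin.prod_univ_succ]
          simp
      · symm
        refine Finset.sum_nbij (fun κ => Fin.succ ∘ κ) ?_ ?_ ?_ ?_
        · intro κ hκ
          simp only [Finset.mem_filter, Finset.mem_univ, true_and] at hκ ⊢
          exact ⟨Fin.strictMono_succ.comp hκ, Fin.succ_ne_zero _⟩
        · intro κ _ κ' _ h
          exact (Fin.succ_injective n).comp_left h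
        · intro ι hι
          obtain ⟨h1, h2⟩ := Finset.mem_filter.1 (Finset.mem_coe.1 hι)
          have h1 : StrictMono ι := (Finset.mem_filter.1 h1).2
          have h3 : ∀ i : Fin (α.length + 1), ι i ≠ 0 := fun i hi => by
            have h4 := h1.monotone (Fin.zero_le i)
            rw [hi] at h4
            exact h2 (Fin.le_zero_iff.1 h4)
          refine ⟨fun i => (ι i).pred (h3 i), ?_, ?_⟩
          · simp only [Finset.coe_filter, Finset.mem_univ, true_and]
            intro i j hij
            exact Fin.pred_lt_pred_iff.2 (h1 hij)
          · funext i
            simp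
        · intro κ hκ
          rfl

theorem monomialDQSym_eq_qsymSum (n : ℕ) (α : List (ℕ × ℕ)) :
    monomialDQSym n α =
      qsymSum (fun i => X (Sum.inl i)) (fun i => X (Sum.inr i)) (List.finRange n) α :=
  sum_strictMono_eq_qsymSum n (fun i => X (Sum.inl i) : Fin n → PolyRing n)
    (fun i => X (Sum.inr i)) α

@[simp] theorem monomialDQSym_nil (n : ℕ) : monomialDQSym n [] = 1 := by
  simp [monomialDQSym_eq_qsymSum]

/-- The bidegree of a variable: `(1, 0)` for `x_i` and `(0, 1)` for `y_i`. -/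
abbrev bidegree (n : ℕ) : Fin n ⊕ Fin n → ℕ × ℕ :=
  Sum.elim (fun _ : Fin n => ((1, 0) : ℕ × ℕ)) (fun _ : Fin n => ((0, 1) : ℕ × ℕ))

theorem mem_bihomogeneousPart {n i j : ℕ} {f : PolyRing n} :
    f ∈ bihomogeneousPart n i j ↔ IsWeightedHomogeneous (bidegree n) f (i, j) := Iff.rfl

theorem X_pow_mul_X_pow_isWeightedHomogeneous {n : ℕ} (p : Fin n) (c : ℕ × ℕ) :
    IsWeightedHomogeneous (bidegree n)
      (X (Sum.inl p) ^ c.1 * X (Sum.inr p) ^ c.2 : PolyRing n) c := by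
  have h1 := (isWeightedHomogeneous_X ℚ (bidegree n) (Sum.inl p)).pow c.1
  have h2 := (isWeightedHomogeneous_X ℚ (bidegree n) (Sum.inr p)).pow c.2
  convert h1.mul h2 using 1
  ext <;> simp

theorem monomialDQSym_isWeightedHomogeneous (n : ℕ) (α : List (ℕ × ℕ)) :
    IsWeightedHomogeneous (bidegree n) (monomialDQSym n α) α.sum := by
  rw [monomialDQSym_eq_qsymSum]
  generalize List.finRange n = ps
  induction ps generalizing α with
  | nil =>
    cases α with
    | nil => simpa using isWeightedHomogeneous_one ℚ (bidegree n)
    | cons c α => simpa using isWeightedHomogeneous_zero ℚ (bidegree n) _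
  | cons p ps ih =>
    cases α with
    | nil => simpa using isWeightedHomogeneous_one ℚ (bidegree n)
    | cons c α =>
      rw [qsymSum_cons_cons]
      refine IsWeightedHomogeneous.add ?_ (ih _)
      rw [List.sum_cons]
      exact (X_pow_mul_X_pow_isWeightedHomogeneous p c).mul (ih α)

theorem constantCoeff_monomialDQSym (n : ℕ) {α : List (ℕ × ℕ)} (hα : IsBicomposition α)
    (hne : α ≠ []) : constantCoeff (monomialDQSym n α) = 0 := by
  rw [monomialDQSym_eq_qsymSum, map_qsymSum]
  obtain ⟨c, α, rfl⟩ := List.exists_cons_of_ne_nil hne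
  have hc := hα c List.mem_cons_self
  induction List.finRange n with
  | nil => simp
  | cons p ps ih =>
    rw [qsymSum_cons_cons, ih, add_zero]
    have : c.1 ≠ 0 ∨ c.2 ≠ 0 := by
      by_contra! h
      exact hc (Prod.ext h.1 h.2)
    rcases this with h | h <;> simp [h]

theorem monomialDQSym_mem_idealDQSym (n : ℕ) {α : List (ℕ × ℕ)} (hα : IsBicomposition α)
    (hne : α ≠ []) : monomialDQSym n α ∈ idealDQSym n :=
  Ideal.subset_span ⟨Submodule.subset_span ⟨α, hα, rfl⟩, constantCoeff_monomialDQSym n hα hne⟩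

/-- The ideal is generated by the `M_α` with `α` nonempty, because a diagonally quasi-symmetric
polynomial differs from a combination of these by a constant. -/
theorem idealDQSym_eq_span (n : ℕ) : idealDQSym n =
    Ideal.span {f | ∃ α : List (ℕ × ℕ), IsBicomposition α ∧ α ≠ [] ∧ f = monomialDQSym n α} := by
  refine le_antisymm (Ideal.span_le.2 ?_) (Ideal.span_le.2 ?_)
  · set J := Ideal.span {f | ∃ α : List (ℕ × ℕ), IsBicomposition α ∧ α ≠ [] ∧
      f = monomialDQSym n α} with hJ
    have hJ0 : J ≤ RingHom.ker (constantCoeff : PolyRing n →+* ℚ) := by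
      refine Ideal.span_le.2 ?_
      rintro _ ⟨α, hα, hne, rfl⟩
      exact constantCoeff_monomialDQSym n hα hne
    rintro f ⟨hf, hf0⟩
    have key : ∃ a : ℚ, f - C a ∈ J := by
      clear hf0
      induction hf using Submodule.span_induction with
      | mem f hf =>
        obtain ⟨α, hα, rfl⟩ := hf
        by_cases hne : α = []
        · exact ⟨1, by simp [hne]⟩
        · exact ⟨0, by rw [C_0, sub_zero]; exact Ideal.subset_span ⟨α, hα, hne, rfl⟩⟩
      | zero => exact ⟨0, by simp⟩
      | add f g _ _ hf hg =>
        obtain ⟨a, ha⟩ := hf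
        obtain ⟨b, hb⟩ := hg
        exact ⟨a + b, by rw [C_add, add_sub_add_comm]; exact add_mem ha hb⟩
      | smul c f _ hf =>
        obtain ⟨a, ha⟩ := hf
        exact ⟨c * a, by rw [smul_eq_C_mul, C_mul, ← mul_sub]; exact J.mul_mem_left _ ha⟩
    obtain ⟨a, ha⟩ := key
    have h1 := hJ0 ha
    rw [RingHom.mem_ker, map_sub, hf0, constantCoeff_C] at h1
    have : a = 0 := by linarith
    simpa [this] using ha
  · rintro _ ⟨α, hα, hne, rfl⟩
    exact monomialDQSym_mem_idealDQSym n hα hne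

/-- The ideal is bihomogeneous: its part of bidegree `(i, j)` is spanned by the multiples of the
`M_α` by monomials that have this bidegree. -/
theorem mem_span_of_mem_idealDQSym {n i j : ℕ} {f : PolyRing n} (hI : f ∈ idealDQSym n)
    (hf : f ∈ bihomogeneousPart n i j) :
    f ∈ Submodule.span ℚ {g : PolyRing n | ∃ (s : Fin n ⊕ Fin n →₀ ℕ) (α : List (ℕ × ℕ)),
      IsBicomposition α ∧ α ≠ [] ∧ Finsupp.weight (bidegree n) s + α.sum = (i, j) ∧
      g = monomial s 1 * monomialDQSym n α} := by
  classical
  have h1 : f ∈ Submodule.span ℚ {g : PolyRing n | ∃ (s : Fin n ⊕ Fin n →₀ ℕ) (α : List (ℕ × ℕ)),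
      IsBicomposition α ∧ α ≠ [] ∧ g = monomial s 1 * monomialDQSym n α} := by
    clear hf
    rw [idealDQSym_eq_span] at hI
    induction hI using Submodule.span_induction with
    | mem f h =>
      obtain ⟨α, hα, hne, rfl⟩ := h
      exact Submodule.subset_span ⟨0, α, hα, hne, by simp⟩
    | zero => exact zero_mem _
    | add f g _ _ hf hg => exact add_mem hf hg
    | smul p f _ hf =>
      induction p using MvPolynomial.induction_on' with
      | add p q hp hq => rw [smul_eq_mul] at hp hq ⊢; rw [add_mul]; exact add_mem hp hq
      | monomial t a =>
        rw [smul_eq_mul]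
        rename_i hf'
        clear hf'
        induction hf using Submodule.span_induction with
        | mem f h =>
          obtain ⟨s, α, hα, hne, rfl⟩ := h
          rw [← mul_assoc, monomial_mul, mul_one, ← mul_one a, ← smul_eq_mul a 1, ← smul_monomial,
            smul_mul_assoc]
          exact Submodule.smul_mem _ _ (Submodule.subset_span ⟨t + s, α, hα, hne, rfl⟩)
        | zero => rw [mul_zero]; exact zero_mem _
        | add f g _ _ hf hg => rw [mul_add]; exact add_mem hf hg
        | smul c f _ hf => rw [mul_smul_comm]; exact Submodule.smul_mem _ _ hf
  have h2 := Submodule.mem_map_of_mem (f := weightedHomogeneousComponent (bidegree n) (i, j)) h1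
  rw [mem_bihomogeneousPart] at hf
  rw [hf.weightedHomogeneousComponent_same] at h2
  refine (Submodule.map_span_le _ _ _).2 (fun g hg => ?_) h2
  obtain ⟨s, α, hα, hne, rfl⟩ := hg
  have h3 := (isWeightedHomogeneous_monomial (bidegree n) s (1 : ℚ) rfl).mul
    (monomialDQSym_isWeightedHomogeneous n α)
  by_cases h4 : Finsupp.weight (bidegree n) s + α.sum = (i, j)
  · rw [h4] at h3
    rw [h3.weightedHomogeneousComponent_same]
    exact Submodule.subset_span ⟨s, α, hα, hne, h4, rfl⟩
  · rw [h3.weightedHomogeneousComponent_ne _ (Ne.symm h4)]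
    exact zero_mem _

theorem exists_monomial_eq_prod {n : ℕ} (s : Fin n ⊕ Fin n →₀ ℕ) :
    ∃ K L : Multiset (Fin n), Finsupp.weight (bidegree n) s = (K.card, L.card) ∧
      monomial s (1 : ℚ) =
        (K.map fun p => X (Sum.inl p)).prod * (L.map fun p => X (Sum.inr p)).prod := by
  induction s using Finsupp.induction_linear with
  | zero => exact ⟨0, 0, by simp; rfl, by simp⟩
  | add s t hs ht =>
    obtain ⟨K, L, h1, h2⟩ := hs
    obtain ⟨K', L', h1', h2'⟩ := ht
    refine ⟨K + K', L + L', by simp [h1, h1'], ?_⟩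
    rw [← one_mul (1 : ℚ), ← monomial_mul, h2, h2']
    simp only [Multiset.map_add, Multiset.prod_add]
    ring
  | single a k =>
    rcases a with p | p
    · exact ⟨Multiset.replicate k p, 0, by
        rw [Finsupp.weight_single]; simp, by
        simp [X_pow_eq_monomial]⟩
    · exact ⟨0, Multiset.replicate k p, by
        rw [Finsupp.weight_single]; simp, by
        simp [X_pow_eq_monomial]⟩

theorem bihomogeneousPart_le_iff {n i j : ℕ} {W : Submodule ℚ (PolyRing n)} :
    bihomogeneousPart n i j ≤ W ↔ ∀ K L : Multiset (Fin n), K.card = i → L.card = j →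
      (K.map fun p => X (Sum.inl p)).prod * (L.map fun p => X (Sum.inr p)).prod ∈ W := by
  constructor
  · rintro h K L rfl rfl
    refine h ?_
    clear h
    rw [mem_bihomogeneousPart]
    have h1 : IsWeightedHomogeneous (bidegree n)
        (K.map fun p => (X (Sum.inl p) : PolyRing n)).prod (K.card, 0) := by
      induction K using Multiset.induction_on with
      | empty => exact isWeightedHomogeneous_one ℚ (bidegree n)
      | cons p K ih =>
        rw [Multiset.map_cons, Multiset.prod_cons]
        convert (isWeightedHomogeneous_X ℚ (bidegree n) (Sum.inl p)).mul ih using 1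
        simp [add_comm]
    have h2 : IsWeightedHomogeneous (bidegree n)
        (L.map fun p => (X (Sum.inr p) : PolyRing n)).prod (0, L.card) := by
      induction L using Multiset.induction_on with
      | empty => exact isWeightedHomogeneous_one ℚ (bidegree n)
      | cons p L ih =>
        rw [Multiset.map_cons, Multiset.prod_cons]
        convert (isWeightedHomogeneous_X ℚ (bidegree n) (Sum.inr p)).mul ih using 1
        simp [add_comm]
    convert h1.mul h2 using 1
    simp
  · intro h f hf
    rw [f.as_sum]
    refine sum_mem fun s hs => ?_
    obtain ⟨K, L, h1, h2⟩ := exists_monomial_eq_prod s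
    have h3 := hf (mem_support_iff.1 hs)
    rw [h1] at h3
    rw [← mul_one (f.coeff s), ← smul_eq_mul, ← smul_monomial, h2]
    exact W.smul_mem _ (h K L (congrArg Prod.fst h3) (congrArg Prod.snd h3))

/-! ### Words over weak and strict separators -/

section Words

variable {A R : Type*} [CommRing R]

/-- The sum over all placements of the letters of a word at positions from a list of the products of
the placed letters, `z a p` being the letter `a` at position `p`. Each letter of the word carries a
separator: after `true` (weak) the next letter may stand at the same position, after `false`
(strict) it has to stand at a later one. The separator of the last letter plays no role. -/
def chain (z : A → ℕ → R) : List ℕ → List (A × Bool) → R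
  | _, [] => 1
  | [], _ :: _ => 0
  | p :: ps, (a, s) :: v =>
      z a p * chain z (if s then p :: ps else ps) v + chain z ps ((a, s) :: v)
  termination_by ps v => ps.length + v.length
  decreasing_by
    · cases s
      · simp; omega
      · simp
    · simp

@[simp] theorem chain_nil (z : A → ℕ → R) (ps : List ℕ) : chain z ps [] = 1 := by
  rw [chain]

@[simp] theorem chain_nil_cons (z : A → ℕ → R) (l : A × Bool) (v : List (A × Bool)) :
    chain z [] (l :: v) = 0 := by
  rw [chain]

theorem chain_cons_cons (z : A → ℕ → R) (p : ℕ) (ps : List ℕ) (a : A) (s : Bool)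
    (v : List (A × Bool)) :
    chain z (p :: ps) ((a, s) :: v) =
      z a p * chain z (if s then p :: ps else ps) v + chain z ps ((a, s) :: v) := by
  rw [chain]

/-- The sum over the placements of a word at the positions `q, …, n - 1`. -/
def tailChain (z : A → ℕ → R) (n q : ℕ) (v : List (A × Bool)) : R :=
  chain z (List.range' q (n - q)) v

@[simp] theorem tailChain_nil (z : A → ℕ → R) (n q : ℕ) : tailChain z n q [] = 1 := by
  simp [tailChain]

theorem tailChain_succ (z : A → ℕ → R) {n q : ℕ} (hq : q < n) (a : A) (s : Bool)
    (v : List (A × Bool)) :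
    tailChain z n (q + 1) ((a, s) :: v) =
      tailChain z n q ((a, s) :: v) - z a q * tailChain z n (if s then q else q + 1) v := by
  have h : List.range' q (n - q) = q :: List.range' (q + 1) (n - (q + 1)) := by
    rw [show n - q = (n - (q + 1)) + 1 by omega, List.range'_succ]
  cases s <;> simp [tailChain, h, chain_cons_cons]

/-- The number of weak separators of a word, not counting the separator of its last letter. -/
def weakCount : List (A × Bool) → ℕ
  | [] => 0
  | (_, s) :: v => (if s = true ∧ v ≠ [] then 1 else 0) + weakCount v

@[simp] theorem weakCount_nil : weakCount ([] : List (A × Bool)) = 0 := rfl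

theorem weakCount_cons_true (a : A) {v : List (A × Bool)} (hv : v ≠ []) :
    weakCount ((a, true) :: v) = 1 + weakCount v := by simp [weakCount, hv]

@[simp] theorem weakCount_cons_false (a : A) (v : List (A × Bool)) :
    weakCount ((a, false) :: v) = weakCount v := by simp [weakCount]

theorem weakCount_cons_le (a : A) (s : Bool) (v : List (A × Bool)) :
    weakCount ((a, s) :: v) ≤ 1 + weakCount v := by
  simp only [weakCount]; split_ifs <;> omega

/-- The word with the given letters, weak separators between them, and a strict separator at the
end: its letters may all stand at one position, and what is appended comes later. -/
def block : List A → List (A × Bool)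
  | [] => []
  | [b] => [(b, false)]
  | b :: c :: bs => (b, true) :: block (c :: bs)

theorem block_ne_nil {bs : List A} (h : bs ≠ []) : block bs ≠ [] := by
  match bs, h with
  | [b], _ => simp [block]
  | b :: c :: bs, _ => simp [block]

theorem block_map_fst (bs : List A) : (block bs).map Prod.fst = bs := by
  match bs with
  | [] => rfl
  | [b] => rfl
  | b :: c :: bs => simp [block, block_map_fst (c :: bs)]

theorem weakCount_block_append {bs : List A} (h : bs ≠ []) (v : List (A × Bool)) :
    weakCount (block bs ++ v) + 1 = bs.length + weakCount v := by
  match bs, h with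
  | [b], _ => simp [block]; omega
  | b :: c :: bs, _ =>
    have := weakCount_block_append (bs := c :: bs) (by simp) v
    have h2 : block (c :: bs) ++ v ≠ [] := by
      simp [block_ne_nil (bs := c :: bs) (by simp)]
    rw [block, List.cons_append, weakCount_cons_true _ h2]
    simp at this ⊢; omega

/-- The product of the letters in a multiset of pairs (letter, position). -/
def varProd (z : A → ℕ → R) (s : Multiset (A × ℕ)) : R :=
  (s.map fun x => z x.1 x.2).prod

@[simp] theorem varProd_zero (z : A → ℕ → R) : varProd z 0 = 1 := by simp [varProd]

theorem varProd_add (z : A → ℕ → R) (s t : Multiset (A × ℕ)) :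
    varProd z (s + t) = varProd z s * varProd z t := by simp [varProd]

@[simp] theorem varProd_singleton (z : A → ℕ → R) (x : A × ℕ) :
    varProd z {x} = z x.1 x.2 := by simp [varProd]

/-- The number of letters at position `k`. -/
def posDeg (s : Multiset (A × ℕ)) (k : ℕ) : ℕ := (s.map Prod.snd).count k

@[simp] theorem posDeg_add (s t : Multiset (A × ℕ)) (k : ℕ) :
    posDeg (s + t) k = posDeg s k + posDeg t k := by simp [posDeg]

theorem posDeg_singleton (a : A) (p k : ℕ) :
    posDeg ({(a, p)} : Multiset (A × ℕ)) k = if k = p then 1 else 0 := by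
  simp [posDeg, Multiset.count_singleton]

theorem posDeg_eq_zero {s : Multiset (A × ℕ)} {k : ℕ} (h : ∀ x ∈ s, x.2 ≠ k) :
    posDeg s k = 0 := by
  simp only [posDeg, Multiset.count_eq_zero, Multiset.mem_map, not_exists, not_and]
  exact h

/-- The additive group generated by `D` and the products of multisets of placed letters that have
content `c`, positions below `n`, and whose sequence of degrees is lexicographically smaller than
`d`, the difference being decided at one of the first `q` positions. -/
def lexLower (z : A → ℕ → R) (n : ℕ) (D : AddSubgroup R) (q : ℕ) (d : ℕ → ℕ) (c : Multiset A) :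
    AddSubgroup R :=
  D ⊔ AddSubgroup.closure {f | ∃ s : Multiset (A × ℕ), f = varProd z s ∧ s.map Prod.fst = c ∧
    (∀ x ∈ s, x.2 < n) ∧ ∃ i < q, (∀ k < i, posDeg s k = d k) ∧ posDeg s i < d i}

section LexLower

variable {z : A → ℕ → R} {n : ℕ} {D : AddSubgroup R}

theorem le_lexLower (q : ℕ) (d : ℕ → ℕ) (c : Multiset A) : D ≤ lexLower z n D q d c := le_sup_left

theorem varProd_mem_lexLower {q : ℕ} {d : ℕ → ℕ} {c : Multiset A} {s : Multiset (A × ℕ)}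
    (hc : s.map Prod.fst = c) (hs : ∀ x ∈ s, x.2 < n) {i : ℕ} (hi : i < q)
    (hk : ∀ k < i, posDeg s k = d k) (hd : posDeg s i < d i) :
    varProd z s ∈ lexLower z n D q d c :=
  (le_sup_right : _ ≤ lexLower z n D q d c)
    (AddSubgroup.subset_closure ⟨s, rfl, hc, hs, i, hi, hk, hd⟩)

theorem lexLower_le {q : ℕ} {d : ℕ → ℕ} {c : Multiset A} {G : AddSubgroup R} (hD : D ≤ G)
    (h : ∀ s : Multiset (A × ℕ), s.map Prod.fst = c → (∀ x ∈ s, x.2 < n) →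
      ∀ i < q, (∀ k < i, posDeg s k = d k) → posDeg s i < d i → varProd z s ∈ G) :
    lexLower z n D q d c ≤ G := by
  refine sup_le hD ((AddSubgroup.closure_le _).2 ?_)
  rintro f ⟨s, rfl, hc, hs, i, hi, hk, hd⟩
  exact h s hc hs i hi hk hd

theorem lexLower_mono {q q' : ℕ} {d d' : ℕ → ℕ} (c : Multiset A) (hq : q ≤ q')
    (hd : ∀ k < q, d k = d' k) {D' : AddSubgroup R} (hD : D ≤ D') :
    lexLower z n D q d c ≤ lexLower z n D' q' d' c := by
  refine lexLower_le (hD.trans (le_lexLower _ _ _)) fun s hc hs i hi hk hdi => ?_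
  refine varProd_mem_lexLower hc hs (hi.trans_le hq) (fun k hki => ?_) ?_
  · rw [hk k hki, hd k (hki.trans hi)]
  · rwa [← hd i hi]

theorem lexLower_succ_le {q : ℕ} {d : ℕ → ℕ} (c : Multiset A) (hd : d q = 0) :
    lexLower z n D (q + 1) d c ≤ lexLower z n D q d c := by
  refine lexLower_le (le_lexLower _ _ _) fun s hc hs i hi hk hdi => ?_
  refine varProd_mem_lexLower hc hs ?_ hk hdi
  rcases Nat.lt_succ_iff_lt_or_eq.1 hi with h | rfl
  · exact h
  · omega

theorem varProd_mul_mem_lexLower {q : ℕ} {d : ℕ → ℕ} {c : Multiset A} {t : Multiset (A × ℕ)}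
    (ht : ∀ x ∈ t, x.2 < n) (hD : ∀ f ∈ D, varProd z t * f ∈ D) {f : R}
    (hf : f ∈ lexLower z n D q d c) :
    varProd z t * f ∈ lexLower z n D q (fun k => posDeg t k + d k) (t.map Prod.fst + c) := by
  have : lexLower z n D q d c ≤
      (lexLower z n D q (fun k => posDeg t k + d k) (t.map Prod.fst + c)).comap
        (AddMonoidHom.mulLeft (varProd z t)) := by
    refine lexLower_le (fun f hf => ?_) fun s hc hs i hi hk hdi => ?_
    · exact le_lexLower _ _ _ (hD f hf)
    · rw [AddSubgroup.mem_comap, AddMonoidHom.coe_mulLeft, ← varProd_add]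
      refine varProd_mem_lexLower (by simp [hc]) ?_ hi (fun k hki => by simp [hk k hki]) (by simpa)
      intro x hx
      rcases Multiset.mem_add.1 hx with h | h
      exacts [ht x h, hs x h]
  exact this hf

/-- A letter at position `q` may be multiplied in, since only the positions below `q` have been
compared. -/
theorem var_mul_mem_lexLower {q : ℕ} {d : ℕ → ℕ} {c : Multiset A} {a : A} (hq : q < n)
    (hD : ∀ f ∈ D, z a q * f ∈ D) {f : R} (hf : f ∈ lexLower z n D q d c) :
    z a q * f ∈ lexLower z n D (q + 1) d (a ::ₘ c) := by
  have h := varProd_mul_mem_lexLower (t := {(a, q)}) (by simpa) (by simpa using hD) hf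
  rw [varProd_singleton] at h
  refine lexLower_mono _ (Nat.le_succ q) (fun k hk => ?_) le_rfl (by simpa using h)
  simp [posDeg_singleton, hk.ne]

end LexLower

/-- The sum over the placements is a sum of products of placed letters whose content is that of the
word and whose positions lie in `[q, n)`. -/
theorem tailChain_mem_closure (z : A → ℕ → R) (n q : ℕ) (v : List (A × Bool)) :
    tailChain z n q v ∈ AddSubgroup.closure {f | ∃ s : Multiset (A × ℕ), f = varProd z s ∧
      s.map Prod.fst = v.map Prod.fst ∧ ∀ x ∈ s, q ≤ x.2 ∧ x.2 < n} := by
  have key : ∀ (ps : List ℕ) (v : List (A × Bool)), chain z ps v ∈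
      AddSubgroup.closure {f | ∃ s : Multiset (A × ℕ), f = varProd z s ∧
        s.map Prod.fst = v.map Prod.fst ∧ ∀ x ∈ s, x.2 ∈ ps} := by
    intro ps v
    induction ps, v using chain.induct with
    | case1 ps => exact AddSubgroup.subset_closure ⟨0, by simp⟩
    | case2 l v => simp
    | case3 p ps a s v ih1 ih2 =>
      rw [chain_cons_cons]
      refine add_mem ?_ ?_
      · have : AddSubgroup.closure {f | ∃ s : Multiset (A × ℕ), f = varProd z s ∧
            s.map Prod.fst = v.map Prod.fst ∧ ∀ x ∈ s, x.2 ∈ p :: ps} ≤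
          (AddSubgroup.closure {f | ∃ t : Multiset (A × ℕ), f = varProd z t ∧
            t.map Prod.fst = ((a, s) :: v).map Prod.fst ∧ ∀ x ∈ t, x.2 ∈ p :: ps}).comap
            (AddMonoidHom.mulLeft (z a p)) := by
          rw [AddSubgroup.closure_le]
          rintro f ⟨s, rfl, hs, hp⟩
          refine AddSubgroup.subset_closure ⟨(a, p) ::ₘ s, by simp [varProd], by simp [hs], ?_⟩
          intro x hx
          rcases Multiset.mem_cons.1 hx with rfl | hx
          exacts [by simp, hp x hx]
        refine this (AddSubgroup.closure_mono ?_ ih1)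
        rintro f ⟨s', rfl, hs, hp⟩
        refine ⟨s', rfl, hs, fun x hx => ?_⟩
        have := hp x hx
        cases s <;> simp_all
      · refine AddSubgroup.closure_mono ?_ ih2
        rintro f ⟨s', rfl, hs, hp⟩
        exact ⟨s', rfl, hs, fun x hx => List.mem_cons_of_mem _ (hp x hx)⟩
  refine AddSubgroup.closure_mono ?_ (key _ v)
  rintro f ⟨s, rfl, hs, hp⟩
  refine ⟨s, rfl, hs, fun x hx => ?_⟩
  have := hp x hx
  rw [List.mem_range'_1] at this
  omega

/-- Letters `bs` standing together at position `q`, followed by a word that is placed after `q`,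
form the leading part of the sum over the placements of `block bs ++ v` from `q` on: all other
placements have fewer letters at position `q`. -/
theorem blockProd_mul_tailChain_sub_mem (z : A → ℕ → R) {n q : ℕ} (hq : q < n) {bs : List A}
    (hbs : bs ≠ []) (v : List (A × Bool)) :
    (bs.map (z · q)).prod * tailChain z n (q + 1) v - tailChain z n q (block bs ++ v) ∈
      AddSubgroup.closure {f | ∃ s : Multiset (A × ℕ), f = varProd z s ∧
        s.map Prod.fst = (bs : Multiset A) + (v.map Prod.fst : List A) ∧
        (∀ x ∈ s, q ≤ x.2 ∧ x.2 < n) ∧ posDeg s q < bs.length} := by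
  -- words whose first letter stands after position `q` involve no variable at position `q`
  have aux : ∀ (b : A) (s : Bool) (w : List (A × Bool)) (m : ℕ), 0 < m →
      tailChain z n (q + 1) ((b, s) :: w) ∈
      AddSubgroup.closure {f | ∃ s : Multiset (A × ℕ), f = varProd z s ∧
        s.map Prod.fst = ((b :: w.map Prod.fst : List A) : Multiset A) ∧
        (∀ x ∈ s, q ≤ x.2 ∧ x.2 < n) ∧ posDeg s q < m} := by
    intro b s w m hm
    refine AddSubgroup.closure_mono ?_ (tailChain_mem_closure z n (q + 1) ((b, s) :: w))
    rintro f ⟨s, rfl, hs, hp⟩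
    refine ⟨s, rfl, by simpa using hs, fun x hx => ⟨(Nat.le_succ q).trans (hp x hx).1,
      (hp x hx).2⟩, ?_⟩
    rw [posDeg_eq_zero fun x hx => by have := (hp x hx).1; omega]
    exact hm
  induction bs with
  | nil => exact absurd rfl hbs
  | cons b bs ih =>
    rcases bs with - | ⟨b', bs⟩
    · have h := tailChain_succ z hq b false v
      have h2 := neg_mem (aux b false v 1 one_pos)
      simp only [List.map_cons, List.map_nil, List.prod_cons, List.prod_nil, block,
        List.cons_append, List.nil_append] at h2 ⊢
      have h3 : z b q * 1 * tailChain z n (q + 1) v - tailChain z n q ((b, false) :: v) =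
          -tailChain z n (q + 1) ((b, false) :: v) := by
        rw [h]; simp
      rw [h3]
      exact h2
    · have h := tailChain_succ z hq b true (block (b' :: bs) ++ v)
      have h2 := aux b true (block (b' :: bs) ++ v) (b :: b' :: bs).length (by simp)
      have h3 := ih (by simp)
      have h4 : AddSubgroup.closure {f | ∃ s : Multiset (A × ℕ), f = varProd z s ∧
          s.map Prod.fst = ((b' :: bs : List A) : Multiset A) + (v.map Prod.fst : List A) ∧
          (∀ x ∈ s, q ≤ x.2 ∧ x.2 < n) ∧ posDeg s q < (b' :: bs).length} ≤
        (AddSubgroup.closure {f | ∃ s : Multiset (A × ℕ), f = varProd z s ∧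
          s.map Prod.fst = ((b :: b' :: bs : List A) : Multiset A) + (v.map Prod.fst : List A) ∧
          (∀ x ∈ s, q ≤ x.2 ∧ x.2 < n) ∧ posDeg s q < (b :: b' :: bs).length}).comap
            (AddMonoidHom.mulLeft (z b q)) := by
        rw [AddSubgroup.closure_le]
        rintro f ⟨s, rfl, hs, hp, hd⟩
        refine AddSubgroup.subset_closure ⟨{(b, q)} + s, by simp [varProd], ?_, ?_, ?_⟩
        · simp [hs]
        · intro x hx
          rcases Multiset.mem_add.1 hx with hx | hx
          · obtain rfl := Multiset.mem_singleton.1 hx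
            exact ⟨le_rfl, hq⟩
          · exact hp x hx
        · rw [posDeg_add, posDeg_singleton]
          simp at hd ⊢; omega
      have h5 := h4 h3
      rw [AddSubgroup.mem_comap, AddMonoidHom.coe_mulLeft] at h5
      have h6 : ((b :: (block (b' :: bs) ++ v).map Prod.fst : List A) : Multiset A) =
          ((b :: b' :: bs : List A) : Multiset A) + (v.map Prod.fst : List A) := by
        simp [block_map_fst]
      rw [h6] at h2
      convert sub_mem h5 h2 using 1
      rw [h, block, List.cons_append, List.map_cons, List.prod_cons]
      simp only [if_true]
      ring

section LexLower

variable {z : A → ℕ → R} {n : ℕ} {D : AddSubgroup R}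

theorem exists_eq_add_map_mk (μ : Multiset (A × ℕ)) (q : ℕ) (hμ : ∀ x ∈ μ, x.2 < q + 1) :
    ∃ (ν : Multiset (A × ℕ)) (bs : List A), μ = ν + (bs : Multiset A).map (·, q) ∧
      ∀ x ∈ ν, x.2 < q := by
  refine ⟨μ.filter (fun x => x.2 < q), ((μ.filter (fun x => ¬ x.2 < q)).map Prod.fst).toList,
    ?_, fun x hx => (Multiset.mem_filter.1 hx).2⟩
  conv_lhs => rw [← Multiset.filter_add_not (fun x : A × ℕ => x.2 < q) μ]
  congr 1
  rw [Multiset.coe_toList, Multiset.map_map]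
  conv_lhs => rw [← Multiset.map_id (μ.filter _)]
  refine Multiset.map_congr rfl fun x hx => ?_
  have h1 := hμ x (Multiset.mem_of_mem_filter hx)
  have h2 := (Multiset.mem_filter.1 hx).2
  ext <;> simp
  omega

theorem posDeg_map_mk (bs : Multiset A) (q k : ℕ) :
    posDeg (bs.map (·, q)) k = if k = q then bs.card else 0 := by
  simp [posDeg, Multiset.map_map, Multiset.count_replicate, eq_comm]

/-- Removal of the block of letters at position `q` from a monomial: it becomes the beginning of the
word. -/
theorem varProd_add_block_mul_tailChain_mem_lexLower {q : ℕ} (hq : q < n) {bs : List A}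
    (hbs : bs ≠ [])
    {ν : Multiset (A × ℕ)} (hν : ∀ x ∈ ν, x.2 < q) {v : List (A × Bool)}
    (h : varProd z ν * tailChain z n q (block bs ++ v) ∈ lexLower z n D q (posDeg ν)
      (ν.map Prod.fst + ((block bs ++ v).map Prod.fst : List A))) :
    varProd z (ν + (bs : Multiset A).map (·, q)) * tailChain z n (q + 1) v ∈
      lexLower z n D (q + 1) (posDeg (ν + (bs : Multiset A).map (·, q)))
        ((ν + (bs : Multiset A).map (·, q)).map Prod.fst + (v.map Prod.fst : List A)) := by
  have hc : (ν + (bs : Multiset A).map (·, q)).map Prod.fst + (v.map Prod.fst : List A) =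
      ν.map Prod.fst + ((bs : Multiset A) + (v.map Prod.fst : List A)) := by
    simp [Function.comp_def, add_assoc]
  have hc' : ν.map Prod.fst + ((block bs ++ v).map Prod.fst : List A) =
      ν.map Prod.fst + ((bs : Multiset A) + (v.map Prod.fst : List A)) := by
    simp [block_map_fst]
  rw [hc]
  rw [hc'] at h
  generalize hcc : ν.map Prod.fst + ((bs : Multiset A) + (v.map Prod.fst : List A)) = c at h ⊢
  have hd : ∀ k < q, posDeg (ν + (bs : Multiset A).map (·, q)) k = posDeg ν k := fun k hk => by
    rw [posDeg_add, posDeg_map_mk, if_neg hk.ne, add_zero]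
  have hdq : posDeg (ν + (bs : Multiset A).map (·, q)) q = bs.length := by
    rw [posDeg_add, posDeg_map_mk, if_pos rfl, posDeg_eq_zero fun x hx => (hν x hx).ne]
    simp
  generalize hd' : posDeg (ν + (bs : Multiset A).map (·, q)) = d' at hd hdq ⊢
  have h1 := blockProd_mul_tailChain_sub_mem z hq hbs v
  have h2 : AddSubgroup.closure {f | ∃ s : Multiset (A × ℕ), f = varProd z s ∧
        s.map Prod.fst = (bs : Multiset A) + (v.map Prod.fst : List A) ∧
        (∀ x ∈ s, q ≤ x.2 ∧ x.2 < n) ∧ posDeg s q < bs.length} ≤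
      (lexLower z n D (q + 1) d' c).comap (AddMonoidHom.mulLeft (varProd z ν)) := by
    rw [AddSubgroup.closure_le]
    rintro f ⟨s, rfl, hs, hp, hds⟩
    rw [SetLike.mem_coe, AddSubgroup.mem_comap, AddMonoidHom.coe_mulLeft, ← varProd_add]
    refine varProd_mem_lexLower (by simp [hs, ← hcc]) ?_ (Nat.lt_succ_self q) (fun k hk => ?_) ?_
    · intro x hx
      rcases Multiset.mem_add.1 hx with hx | hx
      · exact (hν x hx).trans hq
      · exact (hp x hx).2
    · rw [posDeg_add, hd k hk, posDeg_eq_zero (s := s) fun x hx => ?_, add_zero]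
      have := (hp x hx).1; omega
    · rw [posDeg_add, hdq, posDeg_eq_zero (s := ν) fun x hx => ?_, zero_add]
      · exact hds
      · have := hν x hx; omega
  have h3 := h2 h1
  rw [AddSubgroup.mem_comap, AddMonoidHom.coe_mulLeft] at h3
  have h4 := lexLower_mono (D' := D) c (Nat.le_succ q) (fun k hk => (hd k hk).symm) le_rfl h
  convert add_mem h3 h4 using 1
  rw [varProd_add]
  simp only [varProd, Multiset.map_coe, Multiset.prod_coe, List.map_map, Function.comp_def]
  ring

/-- If every nonempty word over all the positions has sum zero, then a monomial `μ` on the first `q`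
positions, times the sum for a word on the positions from `q` on, is a combination of
lexicographically smaller products, as soon as the number of letters of `μ` and of weak separators
is at least `q`. By induction on `q`: letters at the last position of `μ` are turned into a
beginning of the word, which costs one unit of the count; if there are none, the word is compared
with the same word starting one position earlier. -/
theorem varProd_mul_tailChain_mem_lexLower (hz : ∀ v : List (A × Bool), v ≠ [] → tailChain z n 0 v =
    0)
    {q : ℕ} (hq : q ≤ n) :
    ∀ (μ : Multiset (A × ℕ)) (v : List (A × Bool)), (∀ x ∈ μ, x.2 < q) →
      q ≤ μ.card + weakCount v → (μ = 0 → v ≠ []) →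
      varProd z μ * tailChain z n q v ∈
        lexLower z n ⊥ q (posDeg μ) (μ.map Prod.fst + (v.map Prod.fst : List A)) := by
  induction q with
  | zero =>
    intro μ v hμ _ hne
    have hμ0 : μ = 0 := Multiset.eq_zero_of_forall_notMem fun x hx => by simpa using hμ x hx
    rw [hz v (hne hμ0), mul_zero]
    exact zero_mem _
  | succ q ih =>
    have hqn : q < n := hq
    intro μ v hμ hcard hne
    obtain ⟨ν, bs, rfl, hν⟩ := exists_eq_add_map_mk μ q hμ
    by_cases hbs : bs = []
    · subst hbs
      simp only [Multiset.coe_nil, Multiset.map_zero, add_zero] at *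
      have hd0 : posDeg ν q = 0 := posDeg_eq_zero fun x hx => (hν x hx).ne
      clear hne hμ
      induction v with
      | nil =>
        simp only [weakCount_nil] at hcard
        have hν0 : ν ≠ 0 := by rintro rfl; simp at hcard
        have := ih hqn.le ν [] hν (by simp; omega) (fun h => absurd h hν0)
        rw [tailChain_nil] at this ⊢
        exact lexLower_mono _ (Nat.le_succ q) (fun _ _ => rfl) le_rfl this
      | cons l v ihv =>
        obtain ⟨b, s⟩ := l
        rw [tailChain_succ z hqn, mul_sub]
        have h1 := ih hqn.le ν ((b, s) :: v) hν (by omega) (by simp)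
        refine sub_mem (lexLower_mono _ (Nat.le_succ q) (fun _ _ => rfl) le_rfl h1) ?_
        rw [mul_left_comm]
        have hc : ν.map Prod.fst + (((b, s) :: v).map Prod.fst : List A) =
            b ::ₘ (ν.map Prod.fst + (v.map Prod.fst : List A)) := by
          rw [List.map_cons, ← Multiset.cons_coe, Multiset.add_cons]
        rw [hc]
        refine var_mul_mem_lexLower hqn (by simp) ?_
        cases s
        · simp only [weakCount_cons_false] at hcard
          exact lexLower_succ_le _ hd0 (ihv hcard)
        · have h2 := weakCount_cons_le b true v
          refine ih hqn.le ν v hν (by omega) ?_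
          rintro rfl rfl
          simp [weakCount] at hcard
    · have hcard2 := weakCount_block_append hbs v
      refine varProd_add_block_mul_tailChain_mem_lexLower hqn hbs hν
          (ih hqn.le ν (block bs ++ v) hν ?_ ?_)
      · simp at hcard; omega
      · simp [block_ne_nil hbs]

end LexLower

end Words

/-! ### Words with two special letters -/

section Placements

variable {R : Type*} [CommRing R] {z : Fin 3 → ℕ → R} {n : ℕ} {D : Subring R}

/-- The word of neutral letters `0` with the given separators. -/
def neutralWord (u : List Bool) : List (Fin 3 × Bool) := u.map (fun s => (0, s))

/-- Neutral letters `0` at the given positions. -/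
def neutralVars (K : Multiset ℕ) : Multiset (Fin 3 × ℕ) := K.map (fun p => (0, p))

@[simp] theorem neutralWord_nil : neutralWord [] = [] := rfl

@[simp] theorem neutralWord_cons (s : Bool) (u : List Bool) :
    neutralWord (s :: u) = (0, s) :: neutralWord u := rfl

@[simp] theorem neutralWord_append (u v : List Bool) :
    neutralWord (u ++ v) = neutralWord u ++ neutralWord v := by simp [neutralWord]

@[simp] theorem card_neutralVars (K : Multiset ℕ) : (neutralVars K).card = K.card := by
  simp [neutralVars]

theorem neutralVars_add (K L : Multiset ℕ) :
    neutralVars (K + L) = neutralVars K + neutralVars L := by simp [neutralVars]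

theorem neutralVars_replicate (k q : ℕ) : neutralVars (Multiset.replicate k q) =
    ((List.replicate k (0 : Fin 3) : List (Fin 3)) : Multiset (Fin 3)).map (·, q) := by
  simp [neutralVars, Multiset.coe_replicate]

theorem lt_of_mem_neutralVars {K : Multiset ℕ} {q : ℕ} (hK : ∀ i ∈ K, i < q) :
    ∀ x ∈ neutralVars K, x.2 < q := by
  simp only [neutralVars, Multiset.mem_map]
  rintro x ⟨i, hi, rfl⟩
  exact hK i hi

theorem block_replicate_append (k : ℕ) (b : Fin 3) (bs : List (Fin 3)) :
    block (List.replicate k 0 ++ b :: bs) =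
      neutralWord (List.replicate k true) ++ block (b :: bs) := by
  induction k with
  | zero => simp
  | succ k ih =>
    cases k with
    | zero => simp [block]
    | succ k =>
      simp only [List.replicate_succ, List.cons_append, block] at ih ⊢
      rw [ih]; simp

theorem block_replicate_succ (k : ℕ) : block (List.replicate (k + 1) (0 : Fin 3)) =
    neutralWord (List.replicate k true ++ [false]) := by
  have := block_replicate_append k 0 []
  rw [List.replicate_succ', this]; simp [block]

theorem exists_block_cons_replicate (b : Fin 3) (k : ℕ) :
    ∃ s w, block (b :: List.replicate k 0) = (b, s) :: neutralWord w := by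
  cases k with
  | zero => exact ⟨false, [], rfl⟩
  | succ k => exact ⟨true, _, by rw [← block_replicate_succ, List.replicate_succ]; rfl⟩

theorem exists_eq_add_replicate (K : Multiset ℕ) (q : ℕ) (hK : ∀ i ∈ K, i < q + 1) :
    ∃ (L : Multiset ℕ) (k : ℕ), K = L + Multiset.replicate k q ∧ ∀ i ∈ L, i < q := by
  refine ⟨K.filter (· ≠ q), K.count q, ?_, fun i hi => ?_⟩
  · rw [add_comm, ← Multiset.filter_eq', Multiset.filter_add_not]
  · have := hK i (Multiset.mem_of_mem_filter hi)
    have := (Multiset.mem_filter.1 hi).2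
    omega

theorem varProd_mul_tailChain_neutral_cons_mem (hz : ∀ v : List (Fin 3 × Bool), v ≠ [] → tailChain z
    n 0 v = 0)
    (h0 : ∀ p, z 0 p ∈ D) {q : ℕ} (hq : q < n) {μ : Multiset (Fin 3 × ℕ)}
    (hμ : ∀ x ∈ μ, x.2 < q) {s : Bool} {v : List (Fin 3 × Bool)}
    (hcard : q ≤ μ.card + weakCount (((0 : Fin 3), s) :: v))
    (ht : s = true → varProd z μ * tailChain z n q v ∈
      lexLower z n D.toAddSubgroup q (posDeg μ) (μ.map Prod.fst + (v.map Prod.fst : List (Fin 3))))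
    (hf : s = false → varProd z μ * tailChain z n (q + 1) v ∈
      lexLower z n D.toAddSubgroup (q + 1) (posDeg μ)
        (μ.map Prod.fst + (v.map Prod.fst : List (Fin 3)))) :
    varProd z μ * tailChain z n (q + 1) ((0, s) :: v) ∈
      lexLower z n D.toAddSubgroup (q + 1) (posDeg μ)
        (μ.map Prod.fst + ((List.map Prod.fst (((0 : Fin 3), s) :: v) : List (Fin 3)) :
          Multiset (Fin 3))) := by
  rw [tailChain_succ z hq, mul_sub]
  have h1 := varProd_mul_tailChain_mem_lexLower hz hq.le μ ((0, s) :: v) hμ hcard (by simp)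
  refine sub_mem (lexLower_mono _ (Nat.le_succ q) (fun _ _ => rfl) bot_le h1) ?_
  rw [mul_left_comm]
  have hc : μ.map Prod.fst + ((List.map Prod.fst (((0 : Fin 3), s) :: v) : List (Fin 3)) :
        Multiset (Fin 3)) =
      (0 : Fin 3) ::ₘ (μ.map Prod.fst + (v.map Prod.fst : List (Fin 3))) := by
    rw [List.map_cons, ← Multiset.cons_coe, Multiset.add_cons]
  rw [hc]
  refine var_mul_mem_lexLower hq (fun f hf => D.mul_mem (h0 q) hf) ?_
  cases s
  · exact lexLower_succ_le _ (posDeg_eq_zero fun x hx => (hμ x hx).ne) (hf rfl)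
  · exact ht rfl

theorem varProd_neutralVars_mem (h0 : ∀ p, z 0 p ∈ D) (K : Multiset ℕ) :
    varProd z (neutralVars K) ∈ D := by
  refine multiset_prod_mem _ fun a ha => ?_
  simp only [neutralVars, Multiset.map_map, Multiset.mem_map] at ha
  obtain ⟨p, -, rfl⟩ := ha
  exact h0 p

theorem tailChain_neutralWord_mem (h0 : ∀ p, z 0 p ∈ D) (q : ℕ) (u : List Bool) :
    tailChain z n q (neutralWord u) ∈ D := by
  have key : ∀ (ps : List ℕ) (v : List (Fin 3 × Bool)), (∀ x ∈ v, x.1 = 0) → chain z ps v ∈ D := by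
    intro ps v
    induction ps, v using chain.induct with
    | case1 ps => intro _; simp
    | case2 l v => intro _; simp
    | case3 p ps a s v ih1 ih2 =>
      intro h
      obtain rfl : a = 0 := h _ List.mem_cons_self
      rw [chain_cons_cons]
      exact add_mem (mul_mem (h0 p) (ih1 fun x hx => h x (List.mem_cons_of_mem _ hx))) (ih2 h)
  refine key _ _ fun x hx => ?_
  obtain ⟨s, -, rfl⟩ := List.mem_map.1 hx
  rfl

/-- With one letter fewer than required in `varProd_mul_tailChain_mem_lexLower`, the reduction
modulo `D` still works if the word contains the special letters `1` and `2` next to each other with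
a strict separator: the term that escapes the count has both of them at the same position, and `z 1
p * z 2 p` lies in `D`. -/
theorem neutralVars_mul_adjacent_mem_lexLower (hz : ∀ v : List (Fin 3 × Bool), v ≠ [] → tailChain z
    n 0 v = 0)
    (h0 : ∀ p, z 0 p ∈ D) (h12 : ∀ p, z 1 p * z 2 p ∈ D) {q : ℕ} (hq : q ≤ n) :
    ∀ (K : Multiset ℕ) (u : List Bool) (s : Bool) (v : List Bool), (∀ i ∈ K, i < q) →
      q ≤ K.card + weakCount (neutralWord u ++ (1, false) :: (2, s) :: neutralWord v) + 1 →
      varProd z (neutralVars K) *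
          tailChain z n q (neutralWord u ++ (1, false) :: (2, s) :: neutralWord v) ∈
        lexLower z n D.toAddSubgroup q (posDeg (neutralVars K)) ((neutralVars K).map Prod.fst +
          ((neutralWord u ++ (1, false) :: (2, s) :: neutralWord v).map Prod.fst
            : List (Fin 3))) := by
  induction q with
  | zero =>
    intro K u s v hK _
    rw [hz _ (by simp), mul_zero]
    exact zero_mem _
  | succ q ih =>
    have hqn : q < n := hq
    intro K u s v hK hcard
    obtain ⟨L, k, rfl, hL⟩ := exists_eq_add_replicate K q hK
    cases k with
    | zero =>
      simp only [Multiset.replicate_zero, add_zero] at *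
      induction u with
      | nil =>
        simp only [neutralWord_nil, List.nil_append] at hcard ⊢
        have hμ := lt_of_mem_neutralVars hL
        have h1 := ih hqn.le L [] s v hL (by simp at hcard ⊢; omega)
        have h2 := varProd_mul_tailChain_mem_lexLower hz hqn.le (neutralVars L)
          ((2, s) :: neutralWord v) hμ (by simp at hcard ⊢; omega) (by simp)
        -- Compare the word with the same word started at position `q`: the difference is the sum
        -- over the placements whose first letter `1` is at `q`. Starting the remaining word at `q`
        -- too, instead of strictly after `q`, gives a sum to which the general reduction at level
        -- `q` applies; the excess has both `1` and `2` at `q` and lies in `D`.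
        have h3 : varProd z (neutralVars L) * tailChain z n (q + 1)
            ((1, false) :: (2, s) :: neutralWord v) =
            varProd z (neutralVars L) * tailChain z n q ((1, false) :: (2, s) :: neutralWord v)
            - z 1 q * (varProd z (neutralVars L) * tailChain z n q ((2, s) :: neutralWord v))
            + varProd z (neutralVars L) * (z 1 q * z 2 q) *
              tailChain z n (if s then q else q + 1) (neutralWord v) := by
          rw [tailChain_succ z hqn 1, if_neg (by simp), tailChain_succ z hqn 2]
          ring
        rw [h3]
        refine add_mem (sub_mem ?_ ?_) ?_
        · exact lexLower_mono _ (Nat.le_succ q) (fun _ _ => rfl) le_rfl h1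
        · have h4 := var_mul_mem_lexLower (a := 1) hqn (by simp) h2
          have h5 := lexLower_mono (D' := D.toAddSubgroup) _ le_rfl (fun _ _ => rfl) bot_le h4
          rw [← Multiset.add_cons, Multiset.cons_coe] at h5
          exact h5
        · exact le_lexLower _ _ _ (D.mul_mem (D.mul_mem (varProd_neutralVars_mem h0 L) (h12 q))
            (tailChain_neutralWord_mem h0 _ v))
      | cons s' u ihu =>
        simp only [neutralWord_cons, List.cons_append] at hcard ⊢
        refine varProd_mul_tailChain_neutral_cons_mem hz h0 hqn (lt_of_mem_neutralVars hL)
            (by simpa using by omega) ?_ ?_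
        · rintro rfl
          refine ih hqn.le L u s v hL ?_
          have := weakCount_cons_le (0 : Fin 3) true
            (neutralWord u ++ (1, false) :: (2, s) :: neutralWord v)
          omega
        · rintro rfl
          exact ihu (by simpa using hcard)
    | succ k =>
      have h1 := weakCount_block_append (bs := List.replicate (k + 1) (0 : Fin 3)) (by simp)
        (neutralWord u ++ (1, false) :: (2, s) :: neutralWord v)
      rw [neutralVars_add, neutralVars_replicate]
      refine varProd_add_block_mul_tailChain_mem_lexLower hqn (by simp) (lt_of_mem_neutralVars hL)
          ?_
      rw [block_replicate_succ, ← List.append_assoc, ← neutralWord_append] at h1 ⊢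
      refine ih hqn.le L _ s v hL ?_
      simp at hcard h1 ⊢
      omega

theorem getLastD_append_of_ne_nil (w : List Bool) {u : List Bool} (hu : u ≠ []) (a b : Bool) :
    (w ++ u).getLastD a = u.getLastD b := by
  obtain ⟨u, x, rfl⟩ := List.eq_nil_or_concat u |>.resolve_left hu
  simp [← List.append_assoc]

theorem countP_lt_le_eq {K : Multiset ℕ} {q : ℕ} (hK : ∀ i ∈ K, i < q + 1) (j : ℕ) :
    K.countP (fun i => j < i ∧ i ≤ q) = K.countP (fun i => j < i) :=
  Multiset.countP_congr rfl fun i hi => by have := hK i hi; simp; omega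

/-- The special letter `1` is at position `j` of the monomial and the letter `2` is still in the
word, preceded by the neutral word `u`. The equation between the number of weak separators of `u`
and the number of neutral letters beyond `j` ensures that `u` is used up exactly when the position
`j` is reached; then the letters `1` and `2` become adjacent in the word. The inequalities for `q'`
ensure that `u` is not used up earlier. -/
theorem neutralVars_add_first_mem_lexLower (hz : ∀ v : List (Fin 3 × Bool), v ≠ [] → tailChain z n 0
    v = 0)
    (h0 : ∀ p, z 0 p ∈ D) (h12 : ∀ p, z 1 p * z 2 p ∈ D) {j q : ℕ} (hjq : j + 1 ≤ q) (hq : q ≤ n) :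
    ∀ (K : Multiset ℕ) (u : List Bool) (s : Bool) (v : List Bool), (∀ i ∈ K, i < q) →
      u.count true + K.countP (fun i => j < i) + (j + 1) = q →
      (∀ q', j < q' → q' < q → K.countP (fun i => j < i ∧ i ≤ q') + j < q') →
      u.getLastD true = true →
      q ≤ K.card + 1 + weakCount (neutralWord u ++ (2, s) :: neutralWord v) + 1 →
      varProd z (neutralVars K + {(1, j)}) *
          tailChain z n q (neutralWord u ++ (2, s) :: neutralWord v) ∈
        lexLower z n D.toAddSubgroup q (posDeg (neutralVars K + {(1, j)}))
          ((neutralVars K + {(1, j)}).map Prod.fst +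
            ((neutralWord u ++ (2, s) :: neutralWord v).map Prod.fst : List (Fin 3))) := by
  induction q, hjq using Nat.le_induction with
  | base =>
    intro K u s v hK hu _ hlast hcard
    have hjn : j < n := hq
    -- No weak separators are left in `u`, but its last one is weak: `u` is empty, and `2` becomes
    -- the neighbour of the letter `1` that is removed from position `j`.
    have hu0 : u.count true = 0 := by omega
    have hu' : u = [] := by
      by_contra hne
      obtain ⟨u, x, rfl⟩ := List.eq_nil_or_concat u |>.resolve_left hne
      simp at hlast
      simp [hlast] at hu0
    subst hu'
    obtain ⟨L, k, rfl, hL⟩ := exists_eq_add_replicate K j hK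
    have h1 := weakCount_block_append (bs := List.replicate k (0 : Fin 3) ++ [1]) (by simp)
        ((2, s) :: neutralWord v)
    have h2 : neutralVars (L + Multiset.replicate k j) + {(1, j)} = neutralVars L +
        ((List.replicate k (0 : Fin 3) ++ [1] : List (Fin 3)) : Multiset (Fin 3)).map (·, j) := by
      rw [neutralVars_add, neutralVars_replicate, add_assoc, ← Multiset.coe_add, Multiset.map_add]
      rfl
    rw [h2]
    simp only [neutralWord_nil, List.nil_append] at hcard ⊢
    refine varProd_add_block_mul_tailChain_mem_lexLower hjn (by simp) (lt_of_mem_neutralVars hL) ?_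
    rw [block_replicate_append, List.append_assoc] at h1 ⊢
    refine neutralVars_mul_adjacent_mem_lexLower hz h0 h12 hjn.le L _ s v hL ?_
    simp [block] at hcard h1 ⊢
    omega
  | succ q hjq ih =>
    have hqn : q < n := hq
    intro K u s v hK hu hpart hlast hcard
    -- Together with the equation `hu`, this shows that `u` has a weak separator.
    have hpart' := hpart q (by omega) (by omega)
    rw [countP_lt_le_eq hK] at hpart'
    obtain ⟨L, k, rfl, hL⟩ := exists_eq_add_replicate K q hK
    have hμ : ∀ x ∈ neutralVars L + {(1, j)}, x.2 < q := by
      intro x hx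
      rcases Multiset.mem_add.1 hx with hx | hx
      · exact lt_of_mem_neutralVars hL x hx
      · obtain rfl := Multiset.mem_singleton.1 hx
        exact hjq
    cases k with
    | zero =>
      simp only [Multiset.replicate_zero, add_zero] at *
      induction u with
      | nil => simp at hu; omega
      | cons s' u ihu =>
        simp only [neutralWord_cons, List.cons_append] at hcard ⊢
        refine varProd_mul_tailChain_neutral_cons_mem hz h0 hqn hμ (by simpa using by omega) ?_ ?_
        · rintro rfl
          refine ih hqn.le L u s v hL ?_ (fun q' h h' => hpart q' h (by omega))
            (by rwa [List.getLastD_cons] at hlast) ?_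
          · simp at hu; omega
          · have := weakCount_cons_le (0 : Fin 3) true
              (neutralWord u ++ (2, s) :: neutralWord v)
            omega
        · rintro rfl
          refine ihu ?_ (by simpa using hu) (by simpa using hcard)
          have hne : u ≠ [] := by rintro rfl; simp at hlast
          rw [← hlast]
          exact (getLastD_append_of_ne_nil [false] hne _ _).symm
    | succ k =>
      have h1 := weakCount_block_append (bs := List.replicate (k + 1) (0 : Fin 3)) (by simp)
        (neutralWord u ++ (2, s) :: neutralWord v)
      have hne : u ≠ [] := by rintro rfl; rw [List.count_nil] at hu; omega
      rw [neutralVars_add, neutralVars_replicate, add_right_comm]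
      refine varProd_add_block_mul_tailChain_mem_lexLower hqn (by simp) hμ ?_
      rw [block_replicate_succ, ← List.append_assoc, ← neutralWord_append] at h1 ⊢
      refine ih hqn.le L _ s v hL ?_ (fun q' h h' => ?_) ?_ ?_
      · rw [Multiset.countP_add] at hu
        have : (Multiset.replicate (k + 1) q).countP (fun i => j < i) = k + 1 := by
          rw [Multiset.countP_eq_card.2]
          · simp
          · intro a ha
            rw [Multiset.eq_of_mem_replicate ha]; omega
        simp; omega
      · have := hpart q' h (by omega)
        rw [Multiset.countP_add] at this
        omega
      · rw [getLastD_append_of_ne_nil _ hne _ true, hlast]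
      · simp at hcard h1 ⊢
        omega

/-- The special letters are at positions `j < r` of the monomial, where `r` is the first position
such that at least `r - j` letters stand at the positions in `(j, r]`. When the block of letters at
position `r` is removed, the letter `2` is put at the place in the block that is required for the
reduction of the case where only `1` is left in the monomial. -/
theorem varProd_neutral_pair_mem_lexLower (hz : ∀ v : List (Fin 3 × Bool), v ≠ [] → tailChain z n 0
    v = 0)
    (h0 : ∀ p, z 0 p ∈ D) (h12 : ∀ p, z 1 p * z 2 p ∈ D) {j r q : ℕ} (hjr : j < r)
    (hrq : r + 1 ≤ q) (hq : q ≤ n) :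
    ∀ (K : Multiset ℕ) (u : List Bool), (∀ i ∈ K, i < q) →
      (∀ q', j < q' → q' < r → K.countP (fun i => j < i ∧ i ≤ q') + j < q') →
      r ≤ K.countP (fun i => j < i ∧ i ≤ r) + 1 + j →
      q ≤ K.card + 2 + weakCount (neutralWord u) + 1 →
      varProd z (neutralVars K + {(1, j)} + {(2, r)}) * tailChain z n q (neutralWord u) ∈
        lexLower z n D.toAddSubgroup q (posDeg (neutralVars K + {(1, j)} + {(2, r)}))
          ((neutralVars K + {(1, j)} + {(2, r)}).map Prod.fst +
            ((neutralWord u).map Prod.fst : List (Fin 3))) := by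
  induction q, hrq using Nat.le_induction with
  | base =>
    intro K u hK hpart hr hcard
    have hrn : r < n := hq
    obtain ⟨L, k, rfl, hL⟩ := exists_eq_add_replicate K r hK
    have hμ : ∀ x ∈ neutralVars L + {(1, j)}, x.2 < r := by
      intro x hx
      rcases Multiset.mem_add.1 hx with hx | hx
      · exact lt_of_mem_neutralVars hL x hx
      · obtain rfl := Multiset.mem_singleton.1 hx
        exact hjr
    have hcount : L.countP (fun i => j < i) + j + 1 ≤ r := by
      rcases Nat.lt_or_ge (j + 1) r with h | h
      · have := hpart (r - 1) (by omega) (by omega)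
        rw [Multiset.countP_add] at this
        rw [← countP_lt_le_eq (q := r - 1) fun i hi => by have := hL i hi; omega]
        omega
      · have : L.countP (fun i => j < i) = 0 := by
          rw [Multiset.countP_eq_zero]
          intro i hi
          have := hL i hi
          omega
        omega
    have hr' : r ≤ L.countP (fun i => j < i) + k + 1 + j := by
      rw [countP_lt_le_eq hK, Multiset.countP_add] at hr
      have := Multiset.countP_le_card (fun i => j < i) (Multiset.replicate k r)
      simp only [Multiset.card_replicate] at this
      omega
    -- Of the neutral letters at position `r`, those that are placed before the letter `2` are as
    -- many as are needed to reach the position `j` with the letters `1` and `2` adjacent.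
    obtain ⟨m, hm⟩ := Nat.exists_eq_add_of_le hcount
    obtain ⟨l, rfl⟩ : ∃ l, k = m + l := Nat.exists_eq_add_of_le (by omega)
    have h1 := weakCount_block_append
      (bs := List.replicate m (0 : Fin 3) ++ 2 :: List.replicate l 0) (by simp) (neutralWord u)
    have h2 : neutralVars (L + Multiset.replicate (m + l) r) + {(1, j)} + {(2, r)} =
        neutralVars L + {(1, j)} + ((List.replicate m (0 : Fin 3) ++ 2 :: List.replicate l 0
          : List (Fin 3)) : Multiset (Fin 3)).map (·, r) := by
      rw [Multiset.replicate_add, neutralVars_add, neutralVars_add, neutralVars_replicate,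
        neutralVars_replicate, ← Multiset.coe_add, Multiset.map_add, ← Multiset.cons_coe,
        Multiset.map_cons, ← Multiset.singleton_add]
      abel
    rw [h2]
    refine varProd_add_block_mul_tailChain_mem_lexLower hrn (by simp) hμ ?_
    obtain ⟨s, w, hw⟩ := exists_block_cons_replicate 2 l
    rw [block_replicate_append, hw, List.append_assoc, List.cons_append, ← neutralWord_append]
      at h1 ⊢
    refine neutralVars_add_first_mem_lexLower hz h0 h12 hjr hrn.le L _ s _ hL ?_ (fun q' h h' => ?_)
        ?_ ?_
    · simp; omega
    · have := hpart q' h h'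
      rw [Multiset.countP_add] at this
      omega
    · cases m <;> simp [List.replicate_succ']
    · simp at hcard h1 ⊢
      omega
  | succ q hrq ih =>
    have hqn : q < n := hq
    intro K u hK hpart hr hcard
    obtain ⟨L, k, rfl, hL⟩ := exists_eq_add_replicate K q hK
    have hμ : ∀ x ∈ neutralVars L + {(1, j)} + {(2, r)}, x.2 < q := by
      intro x hx
      rcases Multiset.mem_add.1 hx with hx | hx
      · rcases Multiset.mem_add.1 hx with hx | hx
        · exact lt_of_mem_neutralVars hL x hx
        · obtain rfl := Multiset.mem_singleton.1 hx
          exact hjr.trans hrq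
      · obtain rfl := Multiset.mem_singleton.1 hx
        exact hrq
    cases k with
    | zero =>
      simp only [Multiset.replicate_zero, add_zero] at *
      induction u with
      | nil =>
        have hc : (neutralVars L + {(1, j)} + {(2, r)}).card = L.card + 2 := by simp
        have h1 := varProd_mul_tailChain_mem_lexLower hz hqn.le
            (neutralVars L + {(1, j)} + {(2, r)}) []
          hμ (by rw [hc]; rw [neutralWord_nil] at hcard; omega)
          (fun h => by rw [h] at hc; simp at hc)
        simp only [neutralWord_nil, tailChain_nil] at h1 ⊢
        exact lexLower_mono _ (Nat.le_succ q) (fun _ _ => rfl) bot_le h1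
      | cons s' u ihu =>
        simp only [neutralWord_cons] at hcard ⊢
        refine varProd_mul_tailChain_neutral_cons_mem hz h0 hqn hμ (by simpa using by omega) ?_ ?_
        · rintro rfl
          refine ih hqn.le L u hL hpart hr ?_
          have := weakCount_cons_le (0 : Fin 3) true (neutralWord u)
          omega
        · rintro rfl
          exact ihu (by simpa using hcard)
    | succ k =>
      have h1 := weakCount_block_append (bs := List.replicate (k + 1) (0 : Fin 3)) (by simp)
        (neutralWord u)
      have h2 : neutralVars (L + Multiset.replicate (k + 1) q) + {(1, j)} + {(2, r)} =
          neutralVars L + {(1, j)} + {(2, r)} + ((List.replicate (k + 1) (0 : Fin 3)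
            : List (Fin 3)) : Multiset (Fin 3)).map (·, q) := by
        rw [neutralVars_add, neutralVars_replicate]; abel
      rw [h2]
      refine varProd_add_block_mul_tailChain_mem_lexLower hqn (by simp) hμ ?_
      rw [block_replicate_succ, ← neutralWord_append] at h1 ⊢
      refine ih hqn.le L _ hL (fun q' h h' => ?_) ?_ ?_
      · have := hpart q' h h'
        rw [Multiset.countP_add] at this
        omega
      · have h3 : (Multiset.replicate (k + 1) q).countP (fun i => j < i ∧ i ≤ r) = 0 := by
          rw [Multiset.countP_eq_zero]
          intro i hi
          rw [Multiset.eq_of_mem_replicate hi]; omega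
        rwa [Multiset.countP_add, h3] at hr
      · simp at hcard h1 ⊢
        omega

end Placements

/-! ### The quotient ring -/

section Chain

variable {R : Type*} [CommRing R]

/-- The sum over the placements of a word whose letters are columns is a sum of monomial
quasi-symmetric functions: letters across a weak separator are merged or not. -/
theorem exists_chain_eq_sum_qsymSum (x y : ℕ → R) (v : List ((ℕ × ℕ) × Bool))
    (hv : ∀ l ∈ v, l.1 ≠ (0, 0)) : ∃ Γ : List (List (ℕ × ℕ)),
      (∀ γ ∈ Γ, IsBicomposition γ ∧ (v ≠ [] → γ ≠ [])) ∧
      ∀ ps, chain (fun c p => x p ^ c.1 * y p ^ c.2) ps v = (Γ.map (qsymSum x y ps)).sum := by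
  induction v with
  | nil => exact ⟨[[]], by simp [IsBicomposition], by simp⟩
  | cons l v ih =>
    obtain ⟨c, s⟩ := l
    have hc : c ≠ (0, 0) := hv _ List.mem_cons_self
    obtain ⟨Γ, hΓ, e⟩ := ih fun l hl => hv l (List.mem_cons_of_mem _ hl)
    cases s with
    | false =>
      refine ⟨Γ.map (c :: ·), ?_, fun ps => ?_⟩
      · intro γ hγ
        obtain ⟨γ', hγ', rfl⟩ := List.mem_map.1 hγ
        exact ⟨(hΓ γ' hγ').1.cons hc, by simp⟩
      · induction ps with
        | nil => simp [Function.comp_def]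
        | cons p ps ih =>
          simp only [List.map_map, Function.comp_def, chain_cons_cons, qsymSum_cons_cons,
            List.sum_map_add, List.sum_map_mul_left, ← e] at ih ⊢
          rw [ih]; simp
    | true =>
      refine ⟨Γ.flatMap fun γ => match γ with
        | [] => [[c]]
        | d :: γ => [c :: d :: γ, (c + d) :: γ], ?_, fun ps => ?_⟩
      · intro γ hγ
        obtain ⟨γ', hγ', h⟩ := List.mem_flatMap.1 hγ
        have h1 := (hΓ γ' hγ').1
        rcases γ' with - | ⟨d, γ'⟩
        · obtain rfl := List.mem_singleton.1 h
          exact ⟨h1.cons hc, by simp⟩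
        · have h2 : IsBicomposition γ' := fun e he => h1 e (List.mem_cons_of_mem _ he)
          simp only [List.mem_cons, List.not_mem_nil, or_false] at h
          rcases h with rfl | rfl
          · exact ⟨h1.cons hc, by simp⟩
          · refine ⟨h2.cons ?_, by simp⟩
            intro h
            apply hc
            have h1 := congrArg Prod.fst h
            have h2 := congrArg Prod.snd h
            simp only [Prod.fst_add, Prod.snd_add] at h1 h2
            ext <;> simp <;> omega
      · induction ps with
        | nil =>
          rw [chain_nil_cons]
          symm
          refine List.sum_eq_zero fun a ha => ?_
          obtain ⟨γ, hγ, rfl⟩ := List.mem_map.1 ha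
          obtain ⟨γ', hγ', h⟩ := List.mem_flatMap.1 hγ
          rcases γ' with - | ⟨d, γ'⟩
          · simp at h; simp [h]
          · simp at h; rcases h with rfl | rfl <;> simp
        | cons p ps ih =>
          rw [chain_cons_cons, if_pos rfl, ih, e, ← List.sum_map_mul_left]
          clear ih hΓ e
          induction Γ with
          | nil => simp
          | cons γ Γ ihΓ =>
            simp only [List.map_cons, List.flatMap_cons, List.map_append, List.sum_append,
              List.sum_cons] at ihΓ ⊢
            rcases γ with - | ⟨d, γ⟩
            · simp only [qsymSum_nil, List.map_cons, List.map_nil, List.sum_cons, List.sum_nil,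
                qsymSum_cons_cons] at ihΓ ⊢
              linear_combination ihΓ
            · simp only [List.map_cons, List.map_nil, List.sum_cons, List.sum_nil,
                qsymSum_cons_cons, Prod.fst_add, Prod.snd_add, pow_add] at ihΓ ⊢
              linear_combination ihΓ

theorem map_chain {S A : Type*} [CommRing S] (f : R →+* S) (z : A → ℕ → R) (ps : List ℕ)
    (v : List (A × Bool)) : f (chain z ps v) = chain (fun a p => f (z a p)) ps v := by
  induction ps, v using chain.induct with
  | case1 ps => simp
  | case2 l v => simp
  | case3 p ps a s v ih1 ih2 =>
    simp only [dite_eq_ite] at ih1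
    rw [chain_cons_cons, chain_cons_cons, map_add, map_mul, ih1, ih2]

theorem chain_map_letters {A B : Type*} (g : A → B) (z : B → ℕ → R) (ps : List ℕ)
    (v : List (A × Bool)) :
    chain z ps (v.map (Prod.map g id)) = chain (fun a p => z (g a) p) ps v := by
  induction ps, v using chain.induct with
  | case1 ps => simp
  | case2 l v => simp
  | case3 p ps a s v ih1 ih2 =>
    simp only [dite_eq_ite] at ih1
   
    rw [chain_cons_cons, ← ih1, ← ih2, List.map_cons, Prod.map_apply, chain_cons_cons]; rfl

end Chain

/-- The class of the variable `x` with index `p` in the quotient ring, and `0` for `p ≥ n`. -/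
noncomputable def xClass (n p : ℕ) : PolyRing n ⧸ idealDQSym n :=
  if h : p < n then Ideal.Quotient.mk _ (X (Sum.inl ⟨p, h⟩)) else 0

/-- The class of the variable `y` with index `p` in the quotient ring, and `0` for `p ≥ n`. -/
noncomputable def yClass (n p : ℕ) : PolyRing n ⧸ idealDQSym n :=
  if h : p < n then Ideal.Quotient.mk _ (X (Sum.inr ⟨p, h⟩)) else 0

theorem tailChain_class_eq_zero (n : ℕ) {v : List ((ℕ × ℕ) × Bool)}
    (hv : ∀ l ∈ v, l.1 ≠ (0, 0)) (hne : v ≠ []) :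
    tailChain (fun c p => xClass n p ^ c.1 * yClass n p ^ c.2) n 0 v = 0 := by
  obtain ⟨Γ, hΓ, e⟩ := exists_chain_eq_sum_qsymSum (xClass n) (yClass n) v hv
  rw [tailChain, e]
  refine List.sum_eq_zero fun a ha => ?_
  obtain ⟨γ, hγ, rfl⟩ := List.mem_map.1 ha
  have h1 : List.range' 0 (n - 0) = (List.finRange n).map Fin.val := by
    rw [List.map_coe_finRange_eq_range, List.range_eq_range', Nat.sub_zero]
  have h2 : xClass n ∘ Fin.val = Ideal.Quotient.mk (idealDQSym n) ∘ fun i => X (Sum.inl i) := by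
    funext i; simp [xClass]
  have h3 : yClass n ∘ Fin.val = Ideal.Quotient.mk (idealDQSym n) ∘ fun i => X (Sum.inr i) := by
    funext i; simp [yClass]
  rw [h1, qsymSum_map, h2, h3, ← map_qsymSum, ← monomialDQSym_eq_qsymSum]
  exact Ideal.Quotient.eq_zero_iff_mem.2
    (monomialDQSym_mem_idealDQSym n (hΓ γ hγ).1 ((hΓ γ hγ).2 hne))

/-- The letters with values in the square of the quotient ring: the neutral letter `0` is `(x, x)`,
and the special letters `1` and `2` are `(x, y)` and `(y, x)`. -/
noncomputable def letterPair (n : ℕ) (a : Fin 3) (p : ℕ) :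
    (PolyRing n ⧸ idealDQSym n) × (PolyRing n ⧸ idealDQSym n) :=
  if a = 0 then (xClass n p, xClass n p)
  else if a = 1 then (xClass n p, yClass n p) else (yClass n p, xClass n p)

@[simp] theorem letterPair_zero (n p : ℕ) : letterPair n 0 p = (xClass n p, xClass n p) := by
  simp [letterPair]

@[simp] theorem letterPair_one (n p : ℕ) : letterPair n 1 p = (xClass n p, yClass n p) := by
  simp [letterPair]

@[simp] theorem letterPair_two (n p : ℕ) : letterPair n 2 p = (yClass n p, xClass n p) := by
  simp [letterPair]

theorem tailChain_letterPair_eq_zero (n : ℕ) (v : List (Fin 3 × Bool)) (hv : v ≠ []) :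
    tailChain (letterPair n) n 0 v = 0 := by
  have key : ∀ (f : (PolyRing n ⧸ idealDQSym n) × (PolyRing n ⧸ idealDQSym n) →+*
      PolyRing n ⧸ idealDQSym n) (g : Fin 3 → ℕ × ℕ), (∀ a, g a ≠ (0, 0)) →
      (∀ a p, f (letterPair n a p) = xClass n p ^ (g a).1 * yClass n p ^ (g a).2) →
      f (tailChain (letterPair n) n 0 v) = 0 := by
    intro f g hg hf
    rw [tailChain, map_chain]
    simp only [hf]
    rw [← chain_map_letters g (fun c p => xClass n p ^ c.1 * yClass n p ^ c.2)]
    refine tailChain_class_eq_zero n ?_ (by simpa using hv)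
    intro l hl
    obtain ⟨l, -, rfl⟩ := List.mem_map.1 hl
    exact hg _
  refine Prod.ext ?_ ?_
  · refine key (RingHom.fst _ _) (fun a => if a = 2 then (0, 1) else (1, 0)) ?_ ?_
    · intro a; fin_cases a <;> simp
    · intro a p; fin_cases a <;> simp
  · refine key (RingHom.snd _ _) (fun a => if a = 1 then (0, 1) else (1, 0)) ?_ ?_
    · intro a; fin_cases a <;> simp
    · intro a p; fin_cases a <;> simp

/-- Induction along the lexicographic order on the first `n` terms of a sequence of natural
numbers. -/
theorem lex_induction {α : Type*} (n : ℕ) (d : α → ℕ → ℕ) {P : α → Prop}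
    (h : ∀ a, (∀ b, (∃ i < n, (∀ k < i, d b k = d a k) ∧ d b i < d a i) → P b) → P a) (a : α) :
    P a := by
  have wf : WellFounded fun b a : α => ∃ i < n, (∀ k < i, d b k = d a k) ∧ d b i < d a i := by
    refine Subrelation.wf ?_ (InvImage.wf (fun (a : α) (i : Fin n) => d a i)
      (Pi.Lex.wellFounded (ι := Fin n) (α := fun _ => ℕ) (s := fun {_} => (· < ·)) (· < ·)
        fun _ => wellFounded_lt))
    rintro b a ⟨i, hi, h1, h2⟩
    exact ⟨⟨i, hi⟩, fun j hj => h1 j hj, h2⟩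
  exact wf.induction a h

/-- Every monomial of degree at least `n` lies in the ideal. -/
theorem varProd_letterPair_eq_zero {n : ℕ} (hn : 1 ≤ n) (s : Multiset (Fin 3 × ℕ))
    (hs : ∀ x ∈ s, x.2 < n) (hcard : n ≤ s.card) : varProd (letterPair n) s = 0 := by
  induction s using lex_induction n posDeg with
  | h s ih =>
    have h1 := varProd_mul_tailChain_mem_lexLower (z := letterPair n)
        (tailChain_letterPair_eq_zero n)
      le_rfl s [] hs (by simpa using hcard) (by rintro rfl; simp at hcard; omega)
    rw [tailChain_nil, mul_one] at h1
    rw [← AddSubgroup.mem_bot]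
    refine lexLower_le le_rfl (fun t hc ht i hi hk hd => ?_) h1
    refine ih t ⟨i, hi, hk, hd⟩ ht ?_
    have := congrArg Multiset.card hc
    simp at this
    omega

/-! ### The components of top degree -/

theorem eq_neutralVars_of_map_fst {s : Multiset (Fin 3 × ℕ)} {m : ℕ}
    (h : s.map Prod.fst = Multiset.replicate m 0) : s = neutralVars (s.map Prod.snd) := by
  conv_lhs => rw [← Multiset.map_id s]
  rw [neutralVars, Multiset.map_map]
  refine Multiset.map_congr rfl fun x hx => ?_
  have : x.1 ∈ Multiset.replicate m (0 : Fin 3) := h ▸ Multiset.mem_map_of_mem _ hx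
  exact Prod.ext (Multiset.eq_of_mem_replicate this) rfl

theorem exists_eq_neutralVars_add {s : Multiset (Fin 3 × ℕ)} {m : ℕ} {a : Fin 3}
    (h : s.map Prod.fst = Multiset.replicate m 0 + {a}) :
    ∃ (K : Multiset ℕ) (b : ℕ), K.card = m ∧ s = neutralVars K + {(a, b)} := by
  classical
  rw [add_comm, Multiset.singleton_add] at h
  obtain ⟨x, hx, rfl, h2⟩ := (Multiset.map_eq_cons _ _ _ _).2 h
  refine ⟨(s.erase x).map Prod.snd, x.2, ?_, ?_⟩
  · rw [Multiset.card_map, ← Multiset.card_map Prod.fst, h2, Multiset.card_replicate]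
  · rw [← eq_neutralVars_of_map_fst h2, add_comm, Multiset.singleton_add, Prod.mk.eta,
      Multiset.cons_erase hx]

theorem exists_eq_neutralVars_add_add {s : Multiset (Fin 3 × ℕ)} {m : ℕ} {a a' : Fin 3}
    (h : s.map Prod.fst = Multiset.replicate m 0 + {a} + {a'}) :
    ∃ (K : Multiset ℕ) (b b' : ℕ), K.card = m ∧ s = neutralVars K + {(a, b)} + {(a', b')} := by
  classical
  rw [add_comm, Multiset.singleton_add] at h
  obtain ⟨x, hx, rfl, h2⟩ := (Multiset.map_eq_cons _ _ _ _).2 h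
  obtain ⟨K, b, hK, h3⟩ := exists_eq_neutralVars_add h2
  refine ⟨K, b, x.2, hK, ?_⟩
  rw [← h3, add_comm, Multiset.singleton_add, Prod.mk.eta, Multiset.cons_erase hx]

theorem map_fst_neutralVars (K : Multiset ℕ) :
    (neutralVars K).map Prod.fst = Multiset.replicate K.card 0 := by
  simp [neutralVars]

theorem map_snd_neutralVars (K : Multiset ℕ) : (neutralVars K).map Prod.snd = K := by
  simp [neutralVars]

/-- The diagonal of `S × S`. -/
def diagSubring (S : Type*) [CommRing S] : Subring (S × S) :=
  RingHom.eqLocus (RingHom.fst S S) (RingHom.snd S S)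

theorem mem_diagSubring {S : Type*} [CommRing S] {f : S × S} : f ∈ diagSubring S ↔ f.1 = f.2 :=
  Iff.rfl

theorem varProd_letterPair_neutralVars (n : ℕ) (K : Multiset ℕ) :
    varProd (letterPair n) (neutralVars K) =
      ((K.map (xClass n)).prod, (K.map (xClass n)).prod) := by
  induction K using Multiset.induction_on with
  | empty => rfl
  | cons p K ih =>
    rw [← Multiset.singleton_add, neutralVars_add, varProd_add, ih]
    simp [neutralVars]

/-- In a monomial of degree `n - 1` of degree one in the `y`, the two placements of the `y` given by
the components of the pair of special letters agree modulo the ideal. For a fixed sequence of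
degrees, the placements at positions at least `j` are identified by descending induction on `j`:
either there is a position `r > j` as in `varProd_neutral_pair_mem_lexLower`, or so few letters lie
beyond `j` that the first `j + 1` positions can be reduced on their own. -/
theorem varProd_letterPair_mem_diagSubring {n m : ℕ} (hm : m + 3 = n)
    (s : Multiset (Fin 3 × ℕ)) (hc : s.map Prod.fst = Multiset.replicate m 0 + {1} + {2})
    (hs : ∀ x ∈ s, x.2 < n) : varProd (letterPair n) s ∈ diagSubring _ := by
  induction s using lex_induction n posDeg with
  | h s₀ ih =>
    set η := s₀.map Prod.snd with hη
    have hηcard : η.card + 1 = n := by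
      have := congrArg Multiset.card hc
      simp at this
      simp [hη]; omega
    have hηlt : ∀ i ∈ η, i < n := by
      intro i hi
      obtain ⟨x, hx, rfl⟩ := Multiset.mem_map.1 hi
      exact hs x hx
    -- lexicographically smaller products are settled by induction
    have hlow : lexLower (letterPair n) n (diagSubring _).toAddSubgroup n (posDeg s₀)
        (Multiset.replicate m 0 + {1} + {2}) ≤ (diagSubring _).toAddSubgroup :=
      lexLower_le le_rfl fun t htc ht i hi hk hd => ih t ⟨i, hi, hk, hd⟩ htc ht
    have hz := tailChain_letterPair_eq_zero n
    have h0 : ∀ p, letterPair n 0 p ∈ diagSubring (PolyRing n ⧸ idealDQSym n) := by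
      simp [mem_diagSubring]
    have h12 : ∀ p, letterPair n 1 p * letterPair n 2 p ∈
        diagSubring (PolyRing n ⧸ idealDQSym n) := by
      simp [mem_diagSubring, mul_comm]
    set t : ℕ → PolyRing n ⧸ idealDQSym n :=
      fun a => ((η.erase a).map (xClass n)).prod * yClass n a with ht
    have hsc : ∀ (M : Multiset ℕ) (b : ℕ), M + {b} = b ::ₘ M := fun M b => by
      rw [add_comm, Multiset.singleton_add]
    have htK : ∀ (K : Multiset ℕ) (a b : ℕ), K + {a} + {b} = η →
        (varProd (letterPair n) (neutralVars K + {(1, a)} + {(2, b)}) ∈ diagSubring _ ↔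
          t a = t b) := by
      intro K a b h
      have h1 : η.erase a = K + {b} := by
        rw [← h, add_right_comm, hsc _ a, Multiset.erase_cons_head]
      have h2 : η.erase b = K + {a} := by
        rw [← h, hsc _ b, Multiset.erase_cons_head]
      rw [mem_diagSubring, varProd_add, varProd_add, varProd_letterPair_neutralVars]
      simp only [ht, h1, h2, varProd_singleton, letterPair_one, letterPair_two, Prod.mk_mul_mk,
        Multiset.map_add, Multiset.prod_add, Multiset.map_singleton, Multiset.prod_singleton]
      rw [eq_comm, mul_right_comm]
    have hKab : ∀ a ∈ η, ∀ b ∈ η, a < b → ∃ K : Multiset ℕ, K + {a} + {b} = η := by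
      intro a ha b hb hab
      refine ⟨(η.erase a).erase b, ?_⟩
      rw [hsc, hsc, Multiset.cons_swap, Multiset.cons_erase
          ((Multiset.mem_erase_of_ne hab.ne').2 hb),
        Multiset.cons_erase ha]
    -- the products placing `y` at positions of `η` beyond `j` agree
    have hP : ∀ j ≤ n, ∀ a ∈ η, ∀ b ∈ η, j ≤ a → j ≤ b → t a = t b := by
      refine fun j hj => Nat.decreasingInduction (motive := fun j _ => ∀ a ∈ η, ∀ b ∈ η,
        j ≤ a → j ≤ b → t a = t b) (fun j hj ihj => ?_) ?_ hj
      · suffices hstep : j ∈ η → ∀ b ∈ η, j < b → t j = t b by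
          intro a ha b hb hja hjb
          rcases hja.eq_or_lt with rfl | hja
          · rcases hjb.eq_or_lt with rfl | hjb
            · rfl
            · exact hstep ha b hb hjb
          · rcases hjb.eq_or_lt with rfl | hjb
            · exact (hstep hb a ha hja).symm
            · exact ihj a ha b hb hja hjb
        intro hjη b hb hjb
        by_cases hr : ∃ r, j < r ∧ r ≤ η.countP (fun i => j < i ∧ i ≤ r) + j
        · classical
          obtain ⟨hjr, hr1⟩ := Nat.find_spec hr
          have hmin := fun r' (h : r' < Nat.find hr) => Nat.find_min hr h
          generalize Nat.find hr = r at hjr hr1 hmin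
          have hpart : ∀ q', j < q' → q' < r → η.countP (fun i => j < i ∧ i ≤ q') + j < q' := by
            intro q' h1 h2
            by_contra h3
            exact hmin q' h2 ⟨h1, by omega⟩
          have hrη : r ∈ η := by
            by_contra hrη
            have h1 : η.countP (fun i => j < i ∧ i ≤ r) = η.countP (fun i => j < i ∧ i ≤ r - 1) :=
                by
              refine Multiset.countP_congr rfl fun i hi => ?_
              have : i ≠ r := fun h => hrη (h ▸ hi)
              simp; omega
            rcases Nat.lt_or_ge (j + 1) r with h | h
            · have := hpart (r - 1) (by omega) (by omega)
              omega
            · have h2 : η.countP (fun i => j < i ∧ i ≤ r - 1) = 0 := by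
                rw [Multiset.countP_eq_zero]
                intro i _
                omega
              omega
          obtain ⟨K, hK⟩ := hKab j hjη r hrη hjr
          have hKlt : ∀ i ∈ K, i < n := fun i hi => hηlt i (by rw [← hK]; simp [hi])
          have hKcard : K.card = m := by
            have := congrArg Multiset.card hK
            simp at this; omega
          have h1 := varProd_neutral_pair_mem_lexLower hz h0 h12 hjr (hηlt r hrη) le_rfl K [] hKlt
              ?_ ?_ ?_
          · have hd : posDeg (neutralVars K + {(1, j)} + {(2, r)}) = posDeg s₀ := by
              funext k
              rw [posDeg, posDeg, ← hη, Multiset.map_add, Multiset.map_add, map_snd_neutralVars]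
              simp only [Multiset.map_singleton, hK]
            rw [neutralWord_nil, tailChain_nil, mul_one, hd] at h1
            simp only [Multiset.map_add, map_fst_neutralVars, hKcard, Multiset.map_singleton,
              List.map_nil, Multiset.coe_nil, add_zero] at h1
            rw [← ihj r hrη b hb hjr hjb]
            exact (htK K j r hK).1 (hlow h1)
          · intro q' h1 h2
            have h3 := hpart q' h1 h2
            rw [← hK, Multiset.countP_add, Multiset.countP_add] at h3
            omega
          · rw [← hK, Multiset.countP_add, Multiset.countP_add] at hr1
            have h2 : Multiset.countP (fun i => j < i ∧ i ≤ r) {j} = 0 := by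
              rw [Multiset.countP_eq_zero]; simp
            have h3 := Multiset.countP_le_card (fun i => j < i ∧ i ≤ r) {r}
            rw [Multiset.card_singleton] at h3
            omega
          · simp; omega
        · push Not at hr
          obtain ⟨K, hK⟩ := hKab j hjη b hb hjb
          have hKcard : K.card = m := by
            have := congrArg Multiset.card hK
            simp at this; omega
          rw [← htK K j b hK]
          set s := neutralVars K + {(1, j)} + {(2, b)} with hsdef
          have hsnd : s.map Prod.snd = η := by
            rw [hsdef, Multiset.map_add, Multiset.map_add, map_snd_neutralVars]
            simp only [Multiset.map_singleton, hK]
          have hfst : s.map Prod.fst = Multiset.replicate m 0 + {1} + {2} := by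
            rw [hsdef, Multiset.map_add, Multiset.map_add, map_fst_neutralVars, hKcard]
            rfl
          have hslt : ∀ x ∈ s, x.2 < n := fun x hx =>
            hηlt _ (hsnd ▸ Multiset.mem_map_of_mem _ hx)
          have hd : posDeg s = posDeg s₀ := by
            funext k
            rw [posDeg, posDeg, ← hη, hsnd]
          -- too few letters lie beyond `j`, so the part of `s` up to `j` has enough of them
          have h1 : j + 1 ≤ (s.filter fun x => x.2 < j + 1).card := by
            have h2 := hr (n - 1) (by have := hηlt b hb; omega)
            have h3 : η.countP (fun i => j < i ∧ i ≤ n - 1) =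
                (s.filter fun x => ¬ x.2 < j + 1).card := by
              rw [← hsnd, Multiset.countP_map]
              congr 1
              refine Multiset.filter_congr fun x hx => ?_
              have := hslt x hx
              omega
            have h4 := congrArg Multiset.card
              (Multiset.filter_add_not (fun x : Fin 3 × ℕ => x.2 < j + 1) s)
            rw [Multiset.card_add] at h4
            have h5 : s.card = η.card := by rw [← hsnd, Multiset.card_map]
            omega
          have h2 := varProd_mul_tailChain_mem_lexLower hz (q := j + 1) hj
            (s.filter fun x => x.2 < j + 1) [] (fun x hx => (Multiset.mem_filter.1 hx).2)
            (by simpa using h1) (fun h => by rw [h] at h1; simp at h1)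
          rw [tailChain_nil, mul_one] at h2
          have h3 := varProd_mul_mem_lexLower (t := s.filter fun x => ¬ x.2 < j + 1)
            (fun x hx => hslt x (Multiset.mem_of_mem_filter hx)) (by simp) h2
          have hsplit : (s.filter fun x => ¬ x.2 < j + 1) + (s.filter fun x => x.2 < j + 1) = s :=
            (add_comm _ _).trans (Multiset.filter_add_not (fun x : Fin 3 × ℕ => x.2 < j + 1) s)
          rw [← varProd_add, hsplit] at h3
          refine hlow (lexLower_mono _ (Nat.succ_le_of_lt hj) (fun k hk => ?_) bot_le ?_ (D := ⊥)
            (d := fun k => posDeg (s.filter fun x => ¬ x.2 < j + 1) k +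
              posDeg (s.filter fun x => x.2 < j + 1) k) (q := j + 1))
          · rw [← hd, ← posDeg_add, hsplit]
          · convert h3 using 1
            rw [← hfst, List.map_nil, Multiset.coe_nil, add_zero, ← Multiset.map_add,
              hsplit]
      · intro a ha _ _ hja
        exact absurd (hηlt a ha) (not_lt.2 hja)
    obtain ⟨K, a, b, hK, rfl⟩ := exists_eq_neutralVars_add_add hc
    have hKη : K + {a} + {b} = η := by
      rw [hη, Multiset.map_add, Multiset.map_add, map_snd_neutralVars]; rfl
    exact (htK K a b hKη).2 (hP 0 (Nat.zero_le n) a (by rw [← hKη]; simp) b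
      (by rw [← hKη]; simp) (Nat.zero_le _) (Nat.zero_le _))

/-- A monomial of degree `n - 1` of degree one in the `y` can be rewritten with the `y` at the last
position: if the last position carries a letter, the `y` is moved there; otherwise the monomial
lives on `n - 1` positions and reduces to smaller ones. -/
theorem fst_varProd_mem_span {n m : ℕ} (hm : m + 2 = n) (s : Multiset (Fin 3 × ℕ))
    (hc : s.map Prod.fst = Multiset.replicate m 0 + {2}) (hs : ∀ x ∈ s, x.2 < n) :
    (varProd (letterPair n) s).1 ∈ AddSubgroup.closure {f | ∃ K : Multiset ℕ, K.card = m ∧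
      (∀ i ∈ K, i < n) ∧ f = yClass n (n - 1) * (K.map (xClass n)).prod} := by
  induction s using lex_induction n posDeg with
  | h s ih =>
    set W := AddSubgroup.closure {f | ∃ K : Multiset ℕ, K.card = m ∧
      (∀ i ∈ K, i < n) ∧ f = yClass n (n - 1) * (K.map (xClass n)).prod} with hW
    have hcard : s.card = m + 1 := by
      have := congrArg Multiset.card hc
      simpa using this
    by_cases hlast : ∃ x ∈ s, x.2 = n - 1
    · obtain ⟨x, hx, hx2⟩ := hlast
      obtain ⟨K, b, hK, rfl⟩ := exists_eq_neutralVars_add hc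
      have hKn : ∀ i ∈ K, i < n := fun i hi => by
        have : (0, i) ∈ neutralVars K := Multiset.mem_map_of_mem _ hi
        exact hs (0, i) (Multiset.mem_add.2 (Or.inl this))
      have hbn : b < n := hs (2, b) (by simp)
      rcases Multiset.mem_add.1 hx with hx | hx
      · obtain ⟨i, hi, rfl⟩ := Multiset.mem_map.1 hx
        obtain rfl : i = n - 1 := hx2
        obtain ⟨L, rfl⟩ := Multiset.exists_cons_of_mem hi
        obtain ⟨m, rfl⟩ : ∃ k, m = k + 1 := ⟨L.card, by rw [← hK]; simp⟩
        have h1 := varProd_letterPair_mem_diagSubring (m := m) (by omega)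
          (neutralVars L + {(1, n - 1)} + {(2, b)}) ?_ ?_
        · rw [mem_diagSubring, varProd_add, varProd_add, varProd_letterPair_neutralVars] at h1
          simp only [varProd_singleton, letterPair_one, letterPair_two, Prod.mk_mul_mk] at h1
          refine AddSubgroup.subset_closure ⟨b ::ₘ L, ?_, ?_, ?_⟩
          · simpa using hK
          · intro i hi
            rcases Multiset.mem_cons.1 hi with rfl | hi
            exacts [hbn, hKn i (Multiset.mem_cons_of_mem hi)]
          · rw [varProd_add, varProd_letterPair_neutralVars]
            simp only [varProd_singleton, letterPair_two, Prod.mk_mul_mk, Multiset.map_cons,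
              Multiset.prod_cons]
            linear_combination h1
        · rw [Multiset.map_add, Multiset.map_add, map_fst_neutralVars]
          simp at hK
          rw [hK]; rfl
        · intro x hx
          rcases Multiset.mem_add.1 hx with hx | hx
          · rcases Multiset.mem_add.1 hx with hx | hx
            · obtain ⟨i, hi, rfl⟩ := Multiset.mem_map.1 hx
              exact hKn i (Multiset.mem_cons_of_mem hi)
            · obtain rfl := Multiset.mem_singleton.1 hx
              show n - 1 < n
              omega
          · obtain rfl := Multiset.mem_singleton.1 hx
            exact hbn
      · obtain rfl := Multiset.mem_singleton.1 hx
        obtain rfl : b = n - 1 := hx2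
        refine AddSubgroup.subset_closure ⟨K, hK, hKn, ?_⟩
        rw [varProd_add, varProd_letterPair_neutralVars]
        simp [mul_comm]
    · push Not at hlast
      have h1 := varProd_mul_tailChain_mem_lexLower (z := letterPair n)
        (tailChain_letterPair_eq_zero n) (q := n - 1) (Nat.sub_le _ _) s []
        (fun x hx => by have := hs x hx; have := hlast x hx; omega) (by simp; omega)
        (by rintro rfl; simp at hcard)
      rw [tailChain_nil, mul_one] at h1
      have h2 : lexLower (letterPair n) n ⊥ (n - 1) (posDeg s)
          (s.map Prod.fst + (([] : List (Fin 3 × Bool)).map Prod.fst : List (Fin 3))) ≤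
          W.comap (AddMonoidHom.fst _ _) := by
        refine lexLower_le bot_le fun t htc ht i hi hk hd => ?_
        exact ih t ⟨i, by omega, hk, hd⟩ (by simpa [hc] using htc) ht
      exact h2 h1

theorem quotientPart_le_iff {n i j : ℕ} {W : Submodule ℚ (PolyRing n ⧸ idealDQSym n)} :
    quotientPart n i j ≤ W ↔ ∀ K L : Multiset (Fin n), K.card = i → L.card = j →
      (Ideal.Quotient.mk (idealDQSym n) ((K.map fun p => X (Sum.inl p)).prod *
        (L.map fun p => X (Sum.inr p)).prod)) ∈ W := by
  rw [quotientPart, Submodule.map_le_iff_le_comap, bihomogeneousPart_le_iff]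
  rfl

theorem fst_varProd_letterPair {n : ℕ} (K L : Multiset (Fin n)) :
    (varProd (letterPair n) (neutralVars (K.map Fin.val) + L.map fun p => (2, p.val))).1 =
      Ideal.Quotient.mk (idealDQSym n) ((K.map fun p => X (Sum.inl p)).prod *
        (L.map fun p => X (Sum.inr p)).prod) := by
  rw [varProd_add, varProd_letterPair_neutralVars, map_mul, map_multiset_prod, map_multiset_prod,
    Multiset.map_map, Multiset.map_map, Multiset.map_map, Prod.fst_mul]
  congr 1
  · refine congrArg Multiset.prod (Multiset.map_congr rfl fun p _ => ?_)
    simp [xClass]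
  · induction L using Multiset.induction_on with
    | empty => simp
    | cons p L ih =>
      rw [Multiset.map_cons, Multiset.map_cons, Multiset.prod_cons, ← ih, varProd, varProd,
        Multiset.map_cons, Multiset.prod_cons]
      simp [yClass]

theorem quotientPart_eq_bot {n i j : ℕ} (hn : 1 ≤ n) (hij : n ≤ i + j) :
    quotientPart n i j = ⊥ := by
  rw [eq_bot_iff, quotientPart_le_iff]
  intro K L hK hL
  rw [Submodule.mem_bot, ← fst_varProd_letterPair, varProd_letterPair_eq_zero hn]
  · rfl
  · intro x hx
    rcases Multiset.mem_add.1 hx with hx | hx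
    · refine lt_of_mem_neutralVars (fun i hi => ?_) x hx
      obtain ⟨p, -, rfl⟩ := Multiset.mem_map.1 hi
      exact p.2
    · obtain ⟨p, -, rfl⟩ := Multiset.mem_map.1 hx
      exact p.2
  · simp; omega

/-- Multiplication by the last `y` maps `V_n^{n-2,0}` onto `V_n^{n-2,1}`. -/
theorem quotientPart_le_map {m : ℕ} : quotientPart (m + 2) m 1 ≤
    (quotientPart (m + 2) m 0).map (LinearMap.mulLeft ℚ (yClass (m + 2) (m + 1))) := by
  rw [quotientPart_le_iff]
  intro K L hK hL
  obtain ⟨b, rfl⟩ := Multiset.card_eq_one.1 hL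
  have h1 := fst_varProd_mem_span (n := m + 2) (m := m) rfl
    (neutralVars (K.map Fin.val) + ({b} : Multiset (Fin (m + 2))).map fun p => (2, p.val)) ?_ ?_
  · rw [fst_varProd_letterPair] at h1
    refine (AddSubgroup.closure_le (K := (Submodule.map _ _).toAddSubgroup)).2 ?_ h1
    rintro f ⟨K', hK', hKn, rfl⟩
    refine ⟨_, ?_, rfl⟩
    have h2 := quotientPart_le_iff.1 (le_refl (quotientPart (m + 2) m 0))
      (K'.pmap (fun i hi => (⟨i, hi⟩ : Fin (m + 2))) hKn) 0 (by simpa using hK') rfl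
    rw [Multiset.map_zero, Multiset.prod_zero, mul_one, map_multiset_prod, Multiset.map_map,
      Multiset.map_pmap] at h2
    rw [SetLike.mem_coe, ← Multiset.pmap_eq_map (fun i => i < m + 2) _ _ hKn]
    have h3 : K'.pmap (fun a _ => xClass (m + 2) a) hKn = K'.pmap (fun a h =>
        (Ideal.Quotient.mk (idealDQSym (m + 2)) ∘ fun p => X (Sum.inl p)) ⟨a, h⟩) hKn :=
      Multiset.pmap_congr _ fun i _ hi _ => by simp [xClass, hi]
    rwa [h3]
  · rw [Multiset.map_add, map_fst_neutralVars]
    simp [hK]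
  · intro x hx
    rcases Multiset.mem_add.1 hx with hx | hx
    · refine lt_of_mem_neutralVars (fun i hi => ?_) x hx
      obtain ⟨p, -, rfl⟩ := Multiset.mem_map.1 hi
      exact p.2
    · obtain ⟨p, -, rfl⟩ := Multiset.mem_map.1 hx
      exact p.2

/-! ### Bounds for the Hilbert function -/

/-- The number of bicompositions with sum `p`, by recursion on the sum of all columns but the
first. -/
def bicompositionCount (p : ℕ × ℕ) : ℕ :=
  if p = 0 then 1 else ∑ q ∈ (Finset.Iio p).attach, bicompositionCount q.1
  termination_by p.1 + p.2
  decreasing_by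
    have := Prod.lt_iff.1 (Finset.mem_Iio.1 q.2)
    omega

theorem bicompositionCount_zero : bicompositionCount 0 = 1 := by
  rw [bicompositionCount, if_pos rfl]

theorem bicompositionCount_of_ne_zero {p : ℕ × ℕ} (hp : p ≠ 0) :
    bicompositionCount p = ∑ q ∈ Finset.Iio p, bicompositionCount q := by
  rw [bicompositionCount, if_neg hp, Finset.sum_attach _ bicompositionCount]

theorem exists_finset_bicompositions (p : ℕ × ℕ) : ∃ S : Finset (List (ℕ × ℕ)),
    (∀ α, α ∈ S ↔ IsBicomposition α ∧ α.sum = p) ∧ S.card ≤ bicompositionCount p := by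
  classical
  suffices h : ∃ S : Finset (List (ℕ × ℕ)),
      (∀ α, IsBicomposition α → α.sum = p → α ∈ S) ∧ S.card ≤ bicompositionCount p by
    obtain ⟨S, hS, hcard⟩ := h
    refine ⟨S.filter fun α => IsBicomposition α ∧ α.sum = p, fun α => ?_,
      (Finset.card_filter_le _ _).trans hcard⟩
    rw [Finset.mem_filter]
    exact ⟨fun h => h.2, fun h => ⟨hS α h.1 h.2, h⟩⟩
  induction h : p.1 + p.2 using Nat.strong_induction_on generalizing p with
  | _ m ih =>
  subst h
  have ih' : ∀ q : ℕ × ℕ, q < p → ∃ S : Finset (List (ℕ × ℕ)),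
      (∀ α, IsBicomposition α → α.sum = q → α ∈ S) ∧ S.card ≤ bicompositionCount q := by
    intro q hq
    have := Prod.lt_iff.1 hq
    exact ih (q.1 + q.2) (by omega) q rfl
  choose! S hS hcard using ih'
  by_cases hp : p = 0
  · subst hp
    refine ⟨{[]}, fun α hα hsum => ?_, by simp [bicompositionCount_zero]⟩
    rcases α with - | ⟨c, α⟩
    · simp
    · rw [List.sum_cons] at hsum
      exact absurd (add_eq_zero.1 hsum).1 (hα c List.mem_cons_self)
  · refine ⟨(Finset.Iio p).biUnion fun q => (S q).image ((p - q) :: ·), fun α hα hsum => ?_, ?_⟩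
    · rcases α with - | ⟨c, α⟩
      · exact absurd hsum.symm hp
      · rw [List.sum_cons] at hsum
        have hc : c ≠ 0 := hα c List.mem_cons_self
        have hlt : α.sum < p := by
          rw [← hsum]
          exact lt_add_of_pos_left _ (pos_iff_ne_zero.2 hc)
        refine Finset.mem_biUnion.2 ⟨α.sum, Finset.mem_Iio.2 hlt, Finset.mem_image.2 ⟨α, ?_, ?_⟩⟩
        · exact hS _ hlt α (fun d hd => hα d (List.mem_cons_of_mem _ hd)) rfl
        · rw [← hsum, add_tsub_cancel_right]
    · rw [bicompositionCount_of_ne_zero hp]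
      refine Finset.card_biUnion_le.trans (Finset.sum_le_sum fun q hq => ?_)
      exact Finset.card_image_le.trans (hcard q (Finset.mem_Iio.1 hq))

section FiniteDimension

theorem finiteDimensional_finset_sup {ι V : Type*} [AddCommGroup V] [Module ℚ V] (s : Finset ι)
    (T : ι → Submodule ℚ V) (hT : ∀ i ∈ s, FiniteDimensional ℚ (T i)) :
    FiniteDimensional ℚ (s.sup T : Submodule ℚ V) ∧
      Module.finrank ℚ (s.sup T : Submodule ℚ V) ≤ ∑ i ∈ s, Module.finrank ℚ (T i) := by
  classical
  induction s using Finset.induction_on with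
  | empty =>
    rw [Finset.sup_empty, Finset.sum_empty]
    exact ⟨inferInstance, by simp⟩
  | insert i s hi ih =>
    obtain ⟨h1, h2⟩ := ih fun j hj => hT j (Finset.mem_insert_of_mem hj)
    have h3 := hT i (Finset.mem_insert_self i s)
    rw [Finset.sup_insert, Finset.sum_insert hi]
    exact ⟨inferInstance, (Submodule.finrank_add_le_finrank_add_finrank _ _).trans (by omega)⟩

/-- The monomial of bidegree `(i, j)` given by a multiset of `i` variables `x` and a multiset of
`j` variables `y`. -/
noncomputable def biProd {n i j : ℕ} (p : Sym (Fin n) i × Sym (Fin n) j) : PolyRing n :=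
  ((p.1 : Multiset (Fin n)).map fun p => X (Sum.inl p)).prod *
    ((p.2 : Multiset (Fin n)).map fun p => X (Sum.inr p)).prod

theorem bihomogeneousPart_eq_span (n i j : ℕ) : bihomogeneousPart n i j =
    Submodule.span ℚ (Set.range (biProd (n := n) (i := i) (j := j))) := by
  refine le_antisymm (bihomogeneousPart_le_iff.2 ?_) (Submodule.span_le.2 ?_)
  · rintro K L rfl rfl
    exact Submodule.subset_span ⟨(⟨K, rfl⟩, ⟨L, rfl⟩), rfl⟩
  · rintro _ ⟨⟨K, L⟩, rfl⟩
    exact bihomogeneousPart_le_iff.1 le_rfl K.1 L.1 K.2 L.2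

theorem linearIndependent_biProd (n i j : ℕ) :
    LinearIndependent ℚ (biProd (n := n) (i := i) (j := j)) := by
  have h1 : ∀ M : Multiset (Fin n ⊕ Fin n), (M.map fun a => (X a : PolyRing n)).prod =
      monomial (Multiset.toFinsupp M) 1 := by
    intro M
    induction M using Multiset.induction_on with
    | empty => simp
    | cons a M ih =>
      rw [Multiset.map_cons, Multiset.prod_cons, ih, ← Multiset.singleton_add, map_add, X,
        monomial_mul, one_mul, Multiset.toFinsupp_singleton]
  have h2 : biProd (n := n) (i := i) (j := j) =
      basisMonomials (Fin n ⊕ Fin n) ℚ ∘ fun p => Multiset.toFinsupp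
        ((p.1 : Multiset (Fin n)).map Sum.inl + (p.2 : Multiset (Fin n)).map Sum.inr) := by
    funext p
    rw [Function.comp_apply, coe_basisMonomials]
    dsimp only
    rw [← h1]
    simp [biProd]
  rw [h2]
  refine (basisMonomials (Fin n ⊕ Fin n) ℚ).linearIndependent.comp _ ?_
  rintro ⟨K, L⟩ ⟨K', L'⟩ h
  have h3 := Multiset.toFinsupp.injective h
  refine Prod.ext (Sym.coe_injective ?_) (Sym.coe_injective ?_)
  · ext a
    have := congrArg (Multiset.count (Sum.inl a)) h3
    simpa [Multiset.count_map_eq_count' _ _ Sum.inl_injective, Multiset.count_eq_zero] using this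
  · ext a
    have := congrArg (Multiset.count (Sum.inr a)) h3
    simpa [Multiset.count_map_eq_count' _ _ Sum.inr_injective, Multiset.count_eq_zero] using this

instance finiteDimensional_bihomogeneousPart (n i j : ℕ) :
    FiniteDimensional ℚ (bihomogeneousPart n i j) := by
  rw [bihomogeneousPart_eq_span]
  exact FiniteDimensional.span_of_finite ℚ (Set.finite_range _)

theorem finrank_bihomogeneousPart (n i j : ℕ) :
    Module.finrank ℚ (bihomogeneousPart n i j) = n.multichoose i * n.multichoose j := by
  rw [bihomogeneousPart_eq_span, finrank_span_eq_card (linearIndependent_biProd n i j),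
    Fintype.card_prod, Sym.card_sym_eq_multichoose, Sym.card_sym_eq_multichoose, Fintype.card_fin]

instance finiteDimensional_quotientPart (n i j : ℕ) :
    FiniteDimensional ℚ (quotientPart n i j) := by
  rw [quotientPart]; infer_instance

/-- A space of lifts `T` of the component `V_n^{i,j}` of the quotient, of dimension at most
`dim V_n^{i,j}`. -/
theorem exists_lift_quotientPart (n i j : ℕ) : ∃ T : Submodule ℚ (PolyRing n), T ≤ bihomogeneousPart
    n i j ∧
    FiniteDimensional ℚ T ∧ Module.finrank ℚ T ≤ Module.finrank ℚ (quotientPart n i j) ∧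
    ∀ f ∈ bihomogeneousPart n i j, ∃ t ∈ T, f - t ∈ idealDQSym n := by
  set π := (Ideal.Quotient.mkₐ ℚ (idealDQSym n)).toLinearMap with hπ
  have hπ' : ∀ f ∈ bihomogeneousPart n i j, π f ∈ quotientPart n i j :=
    fun f hf => Submodule.mem_map_of_mem hf
  obtain ⟨σ, hσ⟩ := (π.restrict hπ').exists_rightInverse_of_surjective (by
    rw [LinearMap.range_eq_top]
    rintro ⟨_, f, hf, rfl⟩
    exact ⟨⟨f, hf⟩, rfl⟩)
  set τ := (bihomogeneousPart n i j).subtype ∘ₗ σ with hτ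
  refine ⟨LinearMap.range τ, ?_, inferInstance, LinearMap.finrank_range_le τ, fun f hf => ?_⟩
  · rintro _ ⟨v, rfl⟩
    exact (σ v).2
  · refine ⟨τ ⟨π f, hπ' f hf⟩, ⟨_, rfl⟩, ?_⟩
    have h1 := congrArg Subtype.val (LinearMap.congr_fun hσ ⟨π f, hπ' f hf⟩)
    have h2 : π (τ ⟨π f, hπ' f hf⟩) = π f := h1
    exact Ideal.Quotient.eq.1 h2.symm

end FiniteDimension

theorem mem_bihomogeneousPart_monomial {n : ℕ} (s : Fin n ⊕ Fin n →₀ ℕ) :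
    monomial s (1 : ℚ) ∈ bihomogeneousPart n (Finsupp.weight (bidegree n) s).1
      (Finsupp.weight (bidegree n) s).2 :=
  isWeightedHomogeneous_monomial (bidegree n) s (1 : ℚ) rfl

theorem bicomposition_sum_ne_zero {α : List (ℕ × ℕ)} (hα : IsBicomposition α) (hne : α ≠ []) :
    α.sum ≠ 0 := by
  obtain ⟨c, α, rfl⟩ := List.exists_cons_of_ne_nil hne
  intro h
  rw [List.sum_cons] at h
  exact hα c List.mem_cons_self (add_eq_zero.1 h).1

/-- Graded Nakayama: by induction on the degree, every polynomial is a combination of products of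
an `M_α` and an element of a space of lifts of the quotient. -/
theorem multichoose_mul_le_sum (n : ℕ) (p : ℕ × ℕ) : n.multichoose p.1 * n.multichoose p.2 ≤
    ∑ q ∈ Finset.Iic p, bicompositionCount (p - q) *
      Module.finrank ℚ (quotientPart n q.1 q.2) := by
  choose T hTle hTfin hTrank hT using fun q : ℕ × ℕ => exists_lift_quotientPart n q.1 q.2
  choose S hS hScard using exists_finset_bicompositions
  set W : ℕ × ℕ → Submodule ℚ (PolyRing n) := fun p => (Finset.Iic p).sup fun q =>
    (S (p - q)).sup fun α => (T q).map (LinearMap.mulLeft ℚ (monomialDQSym n α)) with hW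
  have hmem : ∀ (q : ℕ × ℕ) (α : List (ℕ × ℕ)) (t : PolyRing n), IsBicomposition α → t ∈ T q →
      monomialDQSym n α * t ∈ W (q + α.sum) := by
    intro q α t hα ht
    have h1 : q ∈ Finset.Iic (q + α.sum) := Finset.mem_Iic.2 le_self_add
    have h2 : α ∈ S (q + α.sum - q) := (hS _ α).2 ⟨hα, by rw [add_tsub_cancel_left]⟩
    exact Finset.le_sup (f := fun q' => (S (q + α.sum - q')).sup fun α =>
      (T q').map (LinearMap.mulLeft ℚ (monomialDQSym n α))) h1
      (Finset.le_sup (f := fun α => (T q).map (LinearMap.mulLeft ℚ (monomialDQSym n α))) h2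
        ⟨t, ht, rfl⟩)
  have hmul : ∀ (q : ℕ × ℕ) (α : List (ℕ × ℕ)) (f : PolyRing n), IsBicomposition α → f ∈ W q →
      monomialDQSym n α * f ∈ W (q + α.sum) := by
    intro q α f hα hf
    have : W q ≤ (W (q + α.sum)).comap (LinearMap.mulLeft ℚ (monomialDQSym n α)) := by
      refine Finset.sup_le fun r hr => Finset.sup_le fun β hβ => ?_
      obtain ⟨hβ, hβsum⟩ := (hS _ β).1 hβ
      rintro _ ⟨t, ht, rfl⟩
      obtain ⟨Γ, hΓ, e⟩ := exists_qsymSum_mul (fun i => (X (Sum.inl i) : PolyRing n))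
        (fun i => X (Sum.inr i)) α β hα hβ
      have e' := e (List.finRange n)
      rw [← monomialDQSym_eq_qsymSum, ← monomialDQSym_eq_qsymSum] at e'
      rw [Submodule.mem_comap, LinearMap.mulLeft_apply, LinearMap.mulLeft_apply, ← mul_assoc, e',
        ← List.sum_map_mul_right]
      refine list_sum_mem fun a ha => ?_
      obtain ⟨γ, hγ, rfl⟩ := List.mem_map.1 ha
      rw [← monomialDQSym_eq_qsymSum]
      have h1 := hmem r γ t (hΓ γ hγ).1 ht
      rwa [(hΓ γ hγ).2, hβsum, add_left_comm, add_tsub_cancel_of_le (Finset.mem_Iic.1 hr),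
        add_comm] at h1
    exact this hf
  have hle : ∀ p : ℕ × ℕ, bihomogeneousPart n p.1 p.2 ≤ W p := by
    intro p
    induction h : p.1 + p.2 using Nat.strong_induction_on generalizing p with
    | _ m ih =>
    subst h
    intro f hf
    obtain ⟨t, ht, htI⟩ := hT p f hf
    rw [← sub_add_cancel f t]
    refine add_mem ?_ ?_
    · refine Submodule.span_le.2 ?_ (mem_span_of_mem_idealDQSym htI (sub_mem hf (hTle p ht)))
      rintro _ ⟨s, α, hα, hne, hsum, rfl⟩
      rw [SetLike.mem_coe, mul_comm]
      have h1 := ih _ ?_ (Finsupp.weight (bidegree n) s) rfl (mem_bihomogeneousPart_monomial s)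
      · have := hmul _ α _ hα h1
        rwa [hsum] at this
      · have h2 := bicomposition_sum_ne_zero hα hne
        have h3 := congrArg Prod.fst hsum
        have h4 := congrArg Prod.snd hsum
        simp only [Prod.fst_add, Prod.snd_add] at h3 h4
        by_contra h5
        exact h2 (Prod.ext (by simp; omega) (by simp; omega))
    · have := hmem p [] t (by simp [IsBicomposition]) ht
      simpa using this
  rw [← finrank_bihomogeneousPart]
  have hfin : ∀ q : ℕ × ℕ, ∀ α ∈ S (p - q), FiniteDimensional ℚ
      ((T q).map (LinearMap.mulLeft ℚ (monomialDQSym n α))) := fun q α _ => inferInstance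
  obtain ⟨h1, h2⟩ := finiteDimensional_finset_sup (Finset.Iic p) (fun q => (S (p - q)).sup fun α =>
    (T q).map (LinearMap.mulLeft ℚ (monomialDQSym n α)))
    (fun q _ => (finiteDimensional_finset_sup _ _ (hfin q)).1)
  refine (Submodule.finrank_mono (hle p)).trans (h2.trans (Finset.sum_le_sum fun q _ => ?_))
  refine (finiteDimensional_finset_sup _ _ (hfin q)).2.trans ?_
  refine (Finset.sum_le_card_nsmul _ _ (Module.finrank ℚ (quotientPart n q.1 q.2))
    fun α _ => ?_).trans ?_
  · exact (Submodule.finrank_map_le _ _).trans (hTrank q)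
  · rw [smul_eq_mul]
    exact Nat.mul_le_mul_right _ (hScard _)

/-- The embedding `R_n → R_{n+1}` that renames the variables with index `i` to those with index
`i + 1`. -/
noncomputable def shift (n : ℕ) : PolyRing n →ₐ[ℚ] PolyRing (n + 1) :=
  rename (Sum.map Fin.succ Fin.succ)

/-- Whether the first pair of variables is used in a monomial of `M_α`, with exponents the first
column of `α`, or not. -/
theorem monomialDQSym_succ_cons (n : ℕ) (c : ℕ × ℕ) (α : List (ℕ × ℕ)) :
    monomialDQSym (n + 1) (c :: α) =
      X (Sum.inl 0) ^ c.1 * X (Sum.inr 0) ^ c.2 * shift n (monomialDQSym n α) +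
        shift n (monomialDQSym n (c :: α)) := by
  have h1 : ∀ β, shift n (monomialDQSym n β) = qsymSum (fun i => X (Sum.inl i))
      (fun i => X (Sum.inr i)) ((List.finRange n).map Fin.succ) β := by
    intro β
    rw [qsymSum_map, monomialDQSym_eq_qsymSum]
    refine (map_qsymSum (shift n).toRingHom _ _ _ _).trans ?_
    congr 1 <;> funext i <;> simp [shift]
  rw [h1, h1, monomialDQSym_eq_qsymSum, List.finRange_succ, qsymSum_cons_cons]

theorem shift_prod (n : ℕ) (K L : Multiset (Fin n)) :
    shift n ((K.map fun p => X (Sum.inl p)).prod * (L.map fun p => X (Sum.inr p)).prod) =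
      ((K.map Fin.succ).map fun p => X (Sum.inl p)).prod *
        ((L.map Fin.succ).map fun p => X (Sum.inr p)).prod := by
  rw [map_mul, map_multiset_prod, map_multiset_prod]
  simp [Multiset.map_map, Function.comp_def, shift]

theorem shift_mem_bihomogeneousPart {n i j : ℕ} {f : PolyRing n}
    (hf : f ∈ bihomogeneousPart n i j) : shift n f ∈ bihomogeneousPart (n + 1) i j := by
  have : bihomogeneousPart n i j ≤ (bihomogeneousPart (n + 1) i j).comap (shift n).toLinearMap := by
    refine bihomogeneousPart_le_iff.2 fun K L hK hL => ?_
    rw [Submodule.mem_comap, AlgHom.toLinearMap_apply, shift_prod]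
    exact bihomogeneousPart_le_iff.1 le_rfl _ _ (by simpa) (by simpa)
  exact this hf

theorem exists_eq_map_succ {n : ℕ} {K : Multiset (Fin (n + 1))} (hK : 0 ∉ K) :
    ∃ L : Multiset (Fin n), K = L.map Fin.succ := by
  induction K using Multiset.induction_on with
  | empty => exact ⟨0, rfl⟩
  | cons a K ih =>
    rw [Multiset.mem_cons, not_or] at hK
    obtain ⟨L, rfl⟩ := ih hK.2
    exact ⟨a.pred (Ne.symm hK.1) ::ₘ L, by simp⟩

/-- Splitting off the first pair of variables: `V_{n+1}` is spanned by the products of a monomial in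
`x₁, y₁` and a lift of an element of `V_n` in the remaining variables. -/
theorem finrank_quotientPart_succ_le (n : ℕ) (p : ℕ × ℕ) :
    Module.finrank ℚ (quotientPart (n + 1) p.1 p.2) ≤
      ∑ q ∈ Finset.Iic p, Module.finrank ℚ (quotientPart n q.1 q.2) := by
  choose T hTle hTfin hTrank hT using fun q : ℕ × ℕ => exists_lift_quotientPart n q.1 q.2
  set mk := Ideal.Quotient.mk (idealDQSym (n + 1)) with hmk
  obtain ⟨z, hzdef⟩ : ∃ z : ℕ × ℕ → PolyRing (n + 1),
    z = fun c => X (Sum.inl 0) ^ c.1 * X (Sum.inr 0) ^ c.2 := ⟨_, rfl⟩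
  have hzmul : ∀ c d, z (c + d) = z c * z d := by
    intro c d
    simp only [hzdef, Prod.fst_add, Prod.snd_add, pow_add]
    ring
  set Φ : ℕ × ℕ → PolyRing n →ₗ[ℚ] PolyRing (n + 1) ⧸ idealDQSym (n + 1) := fun c =>
    (Ideal.Quotient.mkₐ ℚ (idealDQSym (n + 1))).toLinearMap ∘ₗ LinearMap.mulLeft ℚ (z c) ∘ₗ
      (shift n).toLinearMap with hΦ
  have hΦ' : ∀ c f, Φ c f = mk (z c * shift n f) := fun c f => rfl
  set W : ℕ × ℕ → Submodule ℚ (PolyRing (n + 1) ⧸ idealDQSym (n + 1)) := fun p =>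
    (Finset.Iic p).sup fun q => (T q).map (Φ (p - q)) with hW
  have hmem : ∀ q c t, t ∈ T q → mk (z c * shift n t) ∈ W (q + c) := by
    intro q c t ht
    have h1 : q ∈ Finset.Iic (q + c) := Finset.mem_Iic.2 le_self_add
    refine Finset.le_sup (f := fun q' => (T q').map (Φ (q + c - q'))) h1 ⟨t, ht, ?_⟩
    rw [hΦ', add_tsub_cancel_left]
  have hmul : ∀ q c f, f ∈ W q → mk (z c) * f ∈ W (q + c) := by
    intro q c f hf
    have : W q ≤ (W (q + c)).comap (LinearMap.mulLeft ℚ (mk (z c))) := by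
      refine Finset.sup_le fun r hr => ?_
      rintro _ ⟨t, ht, rfl⟩
      rw [Submodule.mem_comap, LinearMap.mulLeft_apply, hΦ', ← map_mul, ← mul_assoc, ← hzmul]
      have := hmem r (c + (q - r)) t ht
      rwa [add_left_comm, add_tsub_cancel_of_le (Finset.mem_Iic.1 hr), add_comm c q] at this
    exact this hf
  have hle : ∀ p : ℕ × ℕ, ∀ f ∈ bihomogeneousPart (n + 1) p.1 p.2, mk f ∈ W p := by
    intro p
    induction h : p.1 + p.2 using Nat.strong_induction_on generalizing p with
    | _ m ih =>
    subst h
    suffices hmon : bihomogeneousPart (n + 1) p.1 p.2 ≤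
        (W p).comap (Ideal.Quotient.mkₐ ℚ (idealDQSym (n + 1))).toLinearMap from
      fun f hf => hmon hf
    refine bihomogeneousPart_le_iff.2 fun K L hK hL => ?_
    rw [Submodule.mem_comap]
    change mk _ ∈ W p
    by_cases hK0 : 0 ∈ K
    · obtain ⟨K, rfl⟩ := Multiset.exists_cons_of_mem hK0
      rw [Multiset.card_cons] at hK
      have h1 := ih (K.card + L.card) (by omega) (K.card, L.card) rfl _
        (bihomogeneousPart_le_iff.1 le_rfl K L rfl rfl)
      have h2 := hmul _ (1, 0) _ h1
      have hp : (K.card, L.card) + (1, 0) = p := Prod.ext (by simpa using hK) (by simpa using hL)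
      rw [← map_mul, hp] at h2
      convert h2 using 2
      simp [hzdef, mul_assoc]
    by_cases hL0 : 0 ∈ L
    · obtain ⟨L, rfl⟩ := Multiset.exists_cons_of_mem hL0
      rw [Multiset.card_cons] at hL
      have h1 := ih (K.card + L.card) (by omega) (K.card, L.card) rfl _
        (bihomogeneousPart_le_iff.1 le_rfl K L rfl rfl)
      have h2 := hmul _ (0, 1) _ h1
      have hp : (K.card, L.card) + (0, 1) = p := Prod.ext (by simpa using hK) (by simpa using hL)
      rw [← map_mul, hp] at h2
      convert h2 using 2
      simp [hzdef, mul_left_comm]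
    obtain ⟨K, rfl⟩ := exists_eq_map_succ hK0
    obtain ⟨L, rfl⟩ := exists_eq_map_succ hL0
    rw [← shift_prod]
    have hf := bihomogeneousPart_le_iff.1 (le_refl (bihomogeneousPart n p.1 p.2)) K L
      (by simpa using hK) (by simpa using hL)
    generalize (K.map fun p => (X (Sum.inl p) : PolyRing n)).prod *
      (L.map fun p => X (Sum.inr p)).prod = f at hf ⊢
    obtain ⟨t, ht, htI⟩ := hT p f hf
    have h0 : mk (shift n t) ∈ W p := by
      have := hmem p 0 t ht
      simpa [hzdef] using this
    have h1 : bihomogeneousPart n p.1 p.2 ⊓ (idealDQSym n).restrictScalars ℚ ≤ (W p).comap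
        ((Ideal.Quotient.mkₐ ℚ (idealDQSym (n + 1))).toLinearMap ∘ₗ (shift n).toLinearMap) := by
      rintro g ⟨hg, hgI⟩
      refine Submodule.span_le.2 ?_ (mem_span_of_mem_idealDQSym hgI hg)
      rintro _ ⟨s, α, hα, hne, hsum, rfl⟩
      change mk (shift n _) ∈ W p
      obtain ⟨c, α, rfl⟩ := List.exists_cons_of_ne_nil hne
      -- modulo the ideal, splitting off the first variables moves `M_α` to smaller degree
      have h2 : mk (shift n (monomialDQSym n (c :: α))) =
          -mk (z c * shift n (monomialDQSym n α)) := by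
        have e : z c * shift n (monomialDQSym n α) + shift n (monomialDQSym n (c :: α)) =
            monomialDQSym (n + 1) (c :: α) := by
          rw [hzdef]; exact (monomialDQSym_succ_cons n c α).symm
        refine eq_neg_of_add_eq_zero_right ((map_add mk _ _).symm.trans ?_)
        rw [e]
        exact Ideal.Quotient.eq_zero_iff_mem.2 (monomialDQSym_mem_idealDQSym _ hα hne)
      have h3 : mk (shift n (monomial s 1 * monomialDQSym n (c :: α))) =
          -(mk (z c) * mk (shift n (monomial s 1 * monomialDQSym n α))) := by
        rw [map_mul, map_mul mk, h2, map_mul mk, map_mul (shift n), map_mul mk]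
        ring
      rw [h3]
      refine neg_mem ?_
      rw [List.sum_cons] at hsum
      have hc : c ≠ 0 := hα c List.mem_cons_self
      set q := Finsupp.weight (bidegree n) s + α.sum with hq
      have h4 : q + c = p := by rw [hq, add_assoc, add_comm _ c]; exact hsum
      have h5 : monomial s 1 * monomialDQSym n α ∈ bihomogeneousPart n q.1 q.2 :=
        (isWeightedHomogeneous_monomial (bidegree n) s (1 : ℚ) rfl).mul
          (monomialDQSym_isWeightedHomogeneous n α)
      have h6 := hmul q c _ (ih (q.1 + q.2) ?_ q rfl _ (shift_mem_bihomogeneousPart h5))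
      · rwa [h4] at h6
      · rw [← h4]
        by_contra h7
        simp only [Prod.fst_add, Prod.snd_add] at h7
        exact hc (Prod.ext (by simp; omega) (by simp; omega))
    have h2 : mk (shift n (f - t)) ∈ W p := h1 ⟨sub_mem hf (hTle p ht), htI⟩
    rw [← sub_add_cancel f t, map_add, map_add]
    exact add_mem h2 h0
  have hWle : quotientPart (n + 1) p.1 p.2 ≤ W p := by
    rintro _ ⟨f, hf, rfl⟩
    exact hle p f hf
  obtain ⟨h1, h2⟩ := finiteDimensional_finset_sup (Finset.Iic p) (fun q => (T q).map (Φ (p - q)))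
    (fun q _ => inferInstance)
  refine (Submodule.finrank_mono hWle).trans (h2.trans (Finset.sum_le_sum fun q _ => ?_))
  exact (Submodule.finrank_map_le _ _).trans (hTrank q)

/-! ### The closed forms and the symmetry -/

section Numerics

theorem sum_Iic_prod {M : Type*} [AddCommMonoid M] (d j : ℕ) (g : ℕ × ℕ → M) :
    ∑ q ∈ Finset.Iic (d, j), g q =
      ∑ e ∈ Finset.range (d + 1), ∑ l ∈ Finset.range (j + 1), g (e, l) := by
  rw [← Finset.sum_product']
  refine Finset.sum_congr ?_ fun _ _ => rfl
  ext ⟨a, b⟩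
  simp [Prod.le_def]

theorem sum_range_multichoose (n d : ℕ) :
    ∑ e ∈ Finset.range (d + 1), n.multichoose e = (n + 1).multichoose d := by
  induction d with
  | zero => simp
  | succ d ih => rw [Finset.sum_range_succ, ih, Nat.multichoose_succ_succ, add_comm]

/-- The dimension of `V_n^{d,0}` for `d ≤ n`. -/
def zeroDim (n d : ℕ) : ℤ := 2 * n.multichoose d - (n + 1).multichoose d

/-- The dimension of `V_n^{d,1}` for `d + 2 ≤ n`. -/
def oneDim (n d : ℕ) : ℤ := 2 * n * n.multichoose d - (n + 1) * (n + 1).multichoose d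

/-- The closed form in degree `0` satisfies with equality the recursion obtained by splitting off a
pair of variables. -/
theorem sum_range_zeroDim (n d : ℕ) :
    ∑ e ∈ Finset.range (d + 1), zeroDim n e = zeroDim (n + 1) d := by
  simp only [zeroDim, Finset.sum_sub_distrib, ← Finset.mul_sum, ← Nat.cast_sum,
    sum_range_multichoose]

theorem sum_range_zeroDim_add_oneDim (n d : ℕ) :
    ∑ e ∈ Finset.range (d + 1), (zeroDim n e + oneDim n e) = oneDim (n + 1) d := by
  rw [Finset.sum_add_distrib, sum_range_zeroDim]
  simp only [zeroDim, oneDim, Finset.sum_sub_distrib, ← Finset.mul_sum, ← Nat.cast_sum,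
    sum_range_multichoose]
  push_cast
  ring

theorem zeroDim_self {n : ℕ} (hn : 1 ≤ n) : zeroDim n n = 0 := by
  obtain ⟨m, rfl⟩ := Nat.exists_eq_add_of_le' hn
  rw [zeroDim, Nat.multichoose_eq, Nat.multichoose_eq]
  have h1 : (m + 1 + 1 + (m + 1) - 1).choose (m + 1) =
      (2 * m + 1).choose m + (2 * m + 1).choose (m + 1) := by
    rw [← Nat.choose_succ_succ]; congr 1; omega
  have h2 : (m + 1 + (m + 1) - 1).choose (m + 1) = (2 * m + 1).choose (m + 1) := by
    congr 1; omega
  rw [h1, h2, ← Nat.choose_symm_half]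
  push_cast
  ring

theorem oneDim_eq_zeroDim (m : ℕ) : oneDim (m + 2) m = zeroDim (m + 2) m := by
  rw [oneDim, zeroDim, Nat.multichoose_eq, Nat.multichoose_eq]
  have h2 : (m + 2 + m - 1).choose m = (2 * m + 1).choose m := by congr 1; omega
  have h3 : (m + 2 + 1 + m - 1).choose m = (2 * m + 2).choose m := by congr 1; omega
  have h4 := Nat.choose_mul_succ_eq (2 * m + 1) m
  rw [show 2 * m + 1 + 1 - m = m + 2 by omega] at h4
  rw [h2, h3]
  zify at h4
  push_cast
  linear_combination h4

/-- The closed form in degree `n - 2` is a Catalan number. -/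
theorem zeroDim_top (m : ℕ) :
    ((m : ℤ) + 2) * zeroDim (m + 2) m = (2 * m + 2).choose (m + 1) := by
  rw [zeroDim, Nat.multichoose_eq, Nat.multichoose_eq]
  have h2 : (m + 2 + m - 1).choose m = (2 * m + 1).choose m := by congr 1; omega
  have h3 : (m + 2 + 1 + m - 1).choose m = (2 * m + 2).choose m := by congr 1; omega
  have h4 := Nat.choose_mul_succ_eq (2 * m + 1) m
  rw [show 2 * m + 1 + 1 - m = m + 2 by omega] at h4
  have h5 : (2 * m + 2).choose (m + 1) = 2 * (2 * m + 1).choose m := by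
    rw [Nat.choose_succ_succ, ← Nat.choose_symm_half]; ring
  rw [h2, h3, h5]
  zify at h4
  push_cast
  linear_combination h4

theorem sum_range_bicompositionCount_zero (d : ℕ) :
    (∑ e ∈ Finset.range (d + 1), (bicompositionCount (e, 0) : ℤ)) =
      2 * bicompositionCount (d, 0) - if d = 0 then 1 else 0 := by
  rcases d with - | d
  · have : bicompositionCount (0, 0) = 1 := bicompositionCount_zero
    simp [this]
  · have h := bicompositionCount_of_ne_zero (p := (d + 1, 0)) (by simp)
    have h1 := sum_Iic_prod (d + 1) 0 bicompositionCount
    rw [← Finset.Iio_insert, Finset.sum_insert (by simp), ← h] at h1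
    simp only [zero_add, Finset.range_one, Finset.sum_singleton] at h1
    rw [← Nat.cast_sum, ← h1]
    push_cast; simp; ring

theorem sum_range_bicompositionCount_one (d : ℕ) :
    (∑ e ∈ Finset.range (d + 1),
      ((bicompositionCount (e, 0) : ℤ) + bicompositionCount (e, 1))) =
      2 * bicompositionCount (d, 1) := by
  have h := bicompositionCount_of_ne_zero (p := (d, 1)) (by simp)
  have h1 := sum_Iic_prod d 1 bicompositionCount
  rw [← Finset.Iio_insert, Finset.sum_insert (by simp), ← h] at h1
  simp only [Nat.reduceAdd, Finset.sum_range_succ _ 1, Finset.range_one,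
    Finset.sum_singleton] at h1
  rw [← two_mul] at h1
  exact_mod_cast h1.symm

theorem coeff_mk_mul_mk (f g : ℕ → ℤ) (d : ℕ) :
    PowerSeries.coeff d (PowerSeries.mk f * PowerSeries.mk g) =
      ∑ e ∈ Finset.range (d + 1), f (d - e) * g e := by
  rw [mul_comm, PowerSeries.coeff_mul, Finset.Nat.sum_antidiagonal_eq_sum_range_succ_mk]
  simp [mul_comm]

theorem mk_one_mul_mk (g : ℕ → ℤ) : PowerSeries.mk (fun _ => (1 : ℤ)) * PowerSeries.mk g =
    PowerSeries.mk fun d => ∑ e ∈ Finset.range (d + 1), g e := by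
  ext d
  rw [coeff_mk_mul_mk, PowerSeries.coeff_mk]
  simp

/-- With `H = 1 / (1 - t)`, the generating functions `P`, `P₁` of the numbers of bicompositions with
second sum `0` and `1` satisfy `P (2 - H) = 1` and `P₁ (2 - H) = H P`, and those of the two closed
forms are `(2 - H) R` and `2 n R - (n + 1) H R`, where `R` is the generating function of the
multiset numbers. -/
theorem sum_bicompositionCount_mul_dim (n d : ℕ) :
    (∑ e ∈ Finset.range (d + 1), (bicompositionCount (d - e, 0) : ℤ) * zeroDim n e =
      n.multichoose d) ∧
    (∑ e ∈ Finset.range (d + 1), ((bicompositionCount (d - e, 1) : ℤ) * zeroDim n e +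
      bicompositionCount (d - e, 0) * oneDim n e) = n.multichoose d * n) := by
  set H : PowerSeries ℤ := PowerSeries.mk fun _ => 1 with hH
  set P : PowerSeries ℤ := PowerSeries.mk fun d => (bicompositionCount (d, 0) : ℤ) with hP
  set P1 : PowerSeries ℤ := PowerSeries.mk fun d => (bicompositionCount (d, 1) : ℤ) with hP1
  set R : PowerSeries ℤ := PowerSeries.mk fun d => (n.multichoose d : ℤ) with hR
  set F0 : PowerSeries ℤ := PowerSeries.mk (zeroDim n) with hF0
  set F1 : PowerSeries ℤ := PowerSeries.mk (oneDim n) with hF1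
  have e1 : H * P = 2 * P - 1 := by
    rw [hH, hP, mk_one_mul_mk]
    ext d
    rw [two_mul, map_sub, map_add, PowerSeries.coeff_mk, PowerSeries.coeff_mk,
      sum_range_bicompositionCount_zero, PowerSeries.coeff_one]
    ring
  have e2 : H * (P + P1) = 2 * P1 := by
    have : P + P1 = PowerSeries.mk fun d =>
        (bicompositionCount (d, 0) : ℤ) + bicompositionCount (d, 1) := by
      ext d; simp [hP, hP1]
    rw [this, hH, mk_one_mul_mk]
    ext d
    rw [two_mul, map_add, PowerSeries.coeff_mk, hP1, PowerSeries.coeff_mk,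
      sum_range_bicompositionCount_one]
    ring
  have e3 : H * R = PowerSeries.mk fun d => ((n + 1).multichoose d : ℤ) := by
    rw [hH, hR, mk_one_mul_mk]
    ext d
    rw [PowerSeries.coeff_mk, PowerSeries.coeff_mk, ← sum_range_multichoose, Nat.cast_sum]
  have e4 : F0 = 2 * R - H * R := by
    rw [e3]
    ext d
    rw [two_mul, map_sub, map_add, hF0, hR, PowerSeries.coeff_mk, PowerSeries.coeff_mk,
      PowerSeries.coeff_mk, zeroDim]
    ring
  have e5 : F1 = 2 * PowerSeries.C (n : ℤ) * R - (PowerSeries.C (n : ℤ) + 1) * (H * R) := by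
    rw [e3]
    ext d
    rw [mul_assoc, two_mul, add_mul, one_mul, map_sub, map_add, map_add, PowerSeries.coeff_C_mul,
      PowerSeries.coeff_C_mul, hF1, hR, PowerSeries.coeff_mk, PowerSeries.coeff_mk,
      PowerSeries.coeff_mk, oneDim]
    ring
  have e6 : P * F0 = R := by rw [e4]; linear_combination (-R) * e1
  have e7 : P1 * F0 + P * F1 = R * PowerSeries.C (n : ℤ) := by
    rw [e4, e5]
    linear_combination (-R * PowerSeries.C (n : ℤ)) * e1 - R * e2
  constructor
  · have := congrArg (PowerSeries.coeff d) e6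
    rwa [hP, hF0, coeff_mk_mul_mk, hR, PowerSeries.coeff_mk] at this
  · have := congrArg (PowerSeries.coeff d) e7
    rwa [map_add, hP1, hP, hF0, hF1, coeff_mk_mul_mk, coeff_mk_mul_mk, PowerSeries.coeff_mul_C, hR,
      PowerSeries.coeff_mk, ← Finset.sum_add_distrib] at this

/-- If `s ≤ f` termwise and the convolution with a nonnegative sequence `c`, `c 0 = 1`, is at least
as large for `s` as for `f`, then `s = f`. -/
theorem eq_of_sum_le {c : ℕ → ℕ} (hc : c 0 = 1) {s f : ℕ → ℤ} {d : ℕ} (hle : ∀ e ≤ d, s e ≤ f e)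
    (hsum : ∑ e ∈ Finset.range (d + 1), (c (d - e) : ℤ) * f e ≤
      ∑ e ∈ Finset.range (d + 1), (c (d - e) : ℤ) * s e) : s d = f d := by
  refine le_antisymm (hle d le_rfl) ?_
  have h1 : ∑ e ∈ Finset.range d, (c (d - e) : ℤ) * s e ≤
      ∑ e ∈ Finset.range d, (c (d - e) : ℤ) * f e :=
    Finset.sum_le_sum fun e he => mul_le_mul_of_nonneg_left
      (hle e (Finset.mem_range.1 he).le) (Int.natCast_nonneg _)
  rw [Finset.sum_range_succ, Finset.sum_range_succ, Nat.sub_self, hc] at hsum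
  push_cast at hsum
  linarith

end Numerics

section Dimensions

theorem finrank_quotientPart_eq_zero {n i j : ℕ} (hn : 1 ≤ n) (hij : n ≤ i + j) :
    Module.finrank ℚ (quotientPart n i j) = 0 := by
  rw [quotientPart_eq_bot hn hij, finrank_bot]

theorem finrank_quotientPart_zero_le {n : ℕ} (hn : 1 ≤ n) {d : ℕ} (hd : d ≤ n) :
    (Module.finrank ℚ (quotientPart n d 0) : ℤ) ≤ zeroDim n d := by
  induction n, hn using Nat.le_induction generalizing d with
  | base =>
    rcases hd.eq_or_lt with rfl | hd
    · rw [finrank_quotientPart_eq_zero le_rfl (by omega), zeroDim_self le_rfl]; rfl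
    · obtain rfl : d = 0 := by omega
      have h1 : Module.finrank ℚ (quotientPart 1 0 0) ≤
          Module.finrank ℚ (bihomogeneousPart 1 0 0) := Submodule.finrank_map_le _ _
      rw [finrank_bihomogeneousPart] at h1
      simp at h1
      simp [zeroDim]
      exact_mod_cast h1
  | succ n hn ih =>
    rcases hd.eq_or_lt with rfl | hd
    · rw [finrank_quotientPart_eq_zero (by omega) (by omega), zeroDim_self (by omega)]; rfl
    · have h1 := finrank_quotientPart_succ_le n (d, 0)
      rw [sum_Iic_prod] at h1
      simp only [zero_add, Finset.range_one, Finset.sum_singleton] at h1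
      rw [← sum_range_zeroDim]
      refine (Int.ofNat_le.2 h1).trans ?_
      push_cast
      exact Finset.sum_le_sum fun e he => ih (by have := Finset.mem_range.1 he; omega)

theorem finrank_quotientPart_zero {n : ℕ} (hn : 1 ≤ n) {d : ℕ} (hd : d ≤ n) :
    (Module.finrank ℚ (quotientPart n d 0) : ℤ) = zeroDim n d := by
  refine eq_of_sum_le (c := fun k => bicompositionCount (k, 0))
    (s := fun d => (Module.finrank ℚ (quotientPart n d 0) : ℤ)) bicompositionCount_zero
    (fun e he => finrank_quotientPart_zero_le hn (he.trans hd)) ?_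
  rw [(sum_bicompositionCount_mul_dim n d).1]
  have h1 := multichoose_mul_le_sum n (d, 0)
  rw [sum_Iic_prod] at h1
  simp only [zero_add, Finset.range_one, Finset.sum_singleton, Nat.multichoose_zero_right,
    mul_one, Prod.mk_sub_mk, Nat.sub_zero] at h1
  exact_mod_cast h1

theorem finrank_quotientPart_one_le {n : ℕ} {d : ℕ} (hd : d + 2 ≤ n) :
    (Module.finrank ℚ (quotientPart n d 1) : ℤ) ≤ oneDim n d := by
  induction n generalizing d with
  | zero => omega
  | succ n ih =>
    rcases hd.eq_or_lt with hd | hd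
    -- In the top degree the recursion would involve components beyond the range of the closed form.
    · obtain rfl : n = d + 1 := by omega
      have h1 := (Submodule.finrank_mono (quotientPart_le_map (m := d))).trans
        (Submodule.finrank_map_le _ _)
      rw [oneDim_eq_zeroDim, ← finrank_quotientPart_zero (by omega) (by omega)]
      exact_mod_cast h1
    · have h1 := finrank_quotientPart_succ_le n (d, 1)
      rw [sum_Iic_prod] at h1
      simp only [Nat.reduceAdd, Finset.sum_range_succ _ 1, Finset.range_one,
        Finset.sum_singleton] at h1
      rw [← sum_range_zeroDim_add_oneDim]
      refine (Int.ofNat_le.2 h1).trans ?_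
      push_cast
      refine Finset.sum_le_sum fun e he => ?_
      have := Finset.mem_range.1 he
      exact add_le_add (finrank_quotientPart_zero (by omega) (by omega)).le (ih (by omega))

theorem finrank_quotientPart_one {n : ℕ} {d : ℕ} (hd : d + 2 ≤ n) :
    (Module.finrank ℚ (quotientPart n d 1) : ℤ) = oneDim n d := by
  refine eq_of_sum_le (c := fun k => bicompositionCount (k, 0))
    (s := fun d => (Module.finrank ℚ (quotientPart n d 1) : ℤ)) bicompositionCount_zero
    (fun e he => finrank_quotientPart_one_le (by omega)) ?_
  have h1 := multichoose_mul_le_sum n (d, 1)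
  rw [sum_Iic_prod] at h1
  simp only [Nat.reduceAdd, Finset.sum_range_succ _ 1, Finset.range_one,
    Finset.sum_singleton, Nat.multichoose_one_right, Prod.mk_sub_mk, Nat.sub_zero,
    Nat.sub_self] at h1
  have h2 := (sum_bicompositionCount_mul_dim n d).2
  rw [Finset.sum_add_distrib] at h2 h1
  have h3 : ∑ e ∈ Finset.range (d + 1), (bicompositionCount (d - e, 1) : ℤ) * zeroDim n e =
      ∑ e ∈ Finset.range (d + 1), (bicompositionCount (d - e, 1) : ℤ) *
        Module.finrank ℚ (quotientPart n e 0) := by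
    refine Finset.sum_congr rfl fun e he => ?_
    have := Finset.mem_range.1 he
    rw [finrank_quotientPart_zero (by omega) (by omega)]
  zify at h1
  linarith

/-- The automorphism of `R_n` that exchanges `x_i` and `y_i`. -/
noncomputable def swapXY (n : ℕ) : PolyRing n →ₐ[ℚ] PolyRing n := rename Sum.swap

theorem swapXY_swapXY {n : ℕ} (f : PolyRing n) : swapXY n (swapXY n f) = f := by
  simp [swapXY, rename_rename]

theorem swapXY_mem_bihomogeneousPart {n i j : ℕ} {f : PolyRing n}
    (hf : f ∈ bihomogeneousPart n i j) : swapXY n f ∈ bihomogeneousPart n j i := by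
  have : bihomogeneousPart n i j ≤ (bihomogeneousPart n j i).comap (swapXY n).toLinearMap := by
    refine bihomogeneousPart_le_iff.2 fun K L hK hL => ?_
    have h := bihomogeneousPart_le_iff.1 (le_refl (bihomogeneousPart n j i)) L K hL hK
    rw [mul_comm] at h
    rw [Submodule.mem_comap, AlgHom.toLinearMap_apply, map_mul, map_multiset_prod,
      map_multiset_prod, Multiset.map_map, Multiset.map_map]
    simpa [Function.comp_def, swapXY] using h
  exact this hf

theorem qsymSum_map_swap {P R : Type*} [CommRing R] (x y : P → R) (ps : List P)
    (α : List (ℕ × ℕ)) : qsymSum x y ps (α.map Prod.swap) = qsymSum y x ps α := by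
  induction ps generalizing α with
  | nil => cases α <;> rfl
  | cons p ps ih =>
    cases α with
    | nil => rfl
    | cons c α =>
      rw [List.map_cons, qsymSum_cons_cons, qsymSum_cons_cons, ih, ← List.map_cons, ih]
      simp [mul_comm]

theorem swapXY_mem_idealDQSym {n : ℕ} {f : PolyRing n} (hf : f ∈ idealDQSym n) :
    swapXY n f ∈ idealDQSym n := by
  have : idealDQSym n ≤ (idealDQSym n).comap (swapXY n).toRingHom := by
    conv_lhs => rw [idealDQSym_eq_span]
    refine Ideal.span_le.2 ?_
    rintro _ ⟨α, hα, hne, rfl⟩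
    have h1 : (swapXY n).toRingHom (monomialDQSym n α) = monomialDQSym n (α.map Prod.swap) := by
      rw [monomialDQSym_eq_qsymSum, monomialDQSym_eq_qsymSum, qsymSum_map_swap, map_qsymSum]
      congr 1 <;> funext i <;> simp [swapXY]
    rw [SetLike.mem_coe, Ideal.mem_comap, h1]
    refine monomialDQSym_mem_idealDQSym n (fun c hc => ?_) (by simpa using hne)
    obtain ⟨d, hd, rfl⟩ := List.mem_map.1 hc
    intro h
    exact hα d hd (by rw [← Prod.swap_swap d, h]; rfl)
  exact this hf

theorem finrank_quotientPart_comm (n i j : ℕ) :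
    Module.finrank ℚ (quotientPart n i j) = Module.finrank ℚ (quotientPart n j i) := by
  have key : ∀ i j, Module.finrank ℚ (quotientPart n j i) ≤
      Module.finrank ℚ (quotientPart n i j) := by
    intro i j
    set Ψ := Ideal.Quotient.liftₐ (idealDQSym n)
      ((Ideal.Quotient.mkₐ ℚ (idealDQSym n)).comp (swapXY n))
      (fun f hf => Ideal.Quotient.eq_zero_iff_mem.2 (swapXY_mem_idealDQSym hf)) with hΨ
    have h1 : quotientPart n j i ≤ (quotientPart n i j).map Ψ.toLinearMap := by
      rintro _ ⟨f, hf, rfl⟩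
      refine ⟨_, ⟨swapXY n f, swapXY_mem_bihomogeneousPart hf, rfl⟩, ?_⟩
      change Ideal.Quotient.mk (idealDQSym n) (swapXY n (swapXY n f)) = _
      rw [swapXY_swapXY]
      rfl
    exact (Submodule.finrank_mono h1).trans (Submodule.finrank_map_le _ _)
  exact le_antisymm (key j i) (key i j)

theorem hilbertMatrix_comm (n a b : ℕ) : hilbertMatrix n a b = hilbertMatrix n b a :=
  finrank_quotientPart_comm n _ _

theorem hilbertMatrix_column_two_top {n : ℕ} (hn : 2 ≤ n) :
    (hilbertMatrix n (n - 1) 2 : ℚ) = 1 / (n : ℚ) * ((2 * n - 2).choose (n - 1) : ℚ) := by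
  obtain ⟨m, rfl⟩ := Nat.exists_eq_add_of_le' hn
  have h1 := finrank_quotientPart_one (n := m + 2) (d := m) le_rfl
  rw [oneDim_eq_zeroDim] at h1
  have h2 := zeroDim_top m
  rw [← h1] at h2
  have h3 : ((m : ℚ) + 2) * hilbertMatrix (m + 2) (m + 2 - 1) 2 = (2 * m + 2).choose (m + 1) := by
    exact_mod_cast h2
  rw [show 2 * (m + 2) - 2 = 2 * m + 2 by omega, show m + 2 - 1 = m + 1 by omega] at *
  rw [← h3]
  push_cast
  have : (m : ℚ) + 2 ≠ 0 := by positivity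
  field_simp

theorem hilbertMatrix_column_two_eq_sum {n i : ℕ} (hi : 1 ≤ i) (hin : i + 2 ≤ n) :
    hilbertMatrix n i 2 =
      ∑ j ∈ Finset.Icc 1 i, ∑ k ∈ Finset.Icc 1 2, hilbertMatrix (n - 1) j k := by
  obtain ⟨d, rfl⟩ := Nat.exists_eq_add_of_le' hi
  obtain ⟨m, rfl⟩ : ∃ m, n = m + 1 := ⟨n - 1, by omega⟩
  have h1 : ∀ j, ∑ k ∈ Finset.Icc 1 2, hilbertMatrix (m + 1 - 1) j k =
      hilbertMatrix m j 1 + hilbertMatrix m j 2 := fun j => by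
    rw [show Finset.Icc 1 2 = {1, 2} from rfl, Finset.sum_pair (by norm_num)]; rfl
  simp only [h1]
  rw [← Finset.Ico_add_one_right_eq_Icc, Finset.sum_Ico_eq_sum_range]
  have h2 : (hilbertMatrix (m + 1) (d + 1) 2 : ℤ) = oneDim (m + 1) d :=
    finrank_quotientPart_one (by omega)
  zify
  rw [h2, ← sum_range_zeroDim_add_oneDim]
  refine Finset.sum_congr (by simp) fun e he => ?_
  have := Finset.mem_range.1 he
  rw [← finrank_quotientPart_zero (by omega) (by omega), ← finrank_quotientPart_one (by omega)]
  rw [add_comm 1 e]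
  simp [hilbertMatrix]

theorem hilbertMatrix_column_two_eq_zero {n i : ℕ} (hn : 1 ≤ n) (hi : n ≤ i) :
    hilbertMatrix n i 2 = 0 :=
  finrank_quotientPart_eq_zero hn (by omega)

end Dimensions

end DiagQSym

theorem mainTheorem3 (n : ℕ) (hn : 1 ≤ n) :
    -- the second column
    (2 ≤ n →
      (DiagQSym.hilbertMatrix n (n - 1) 2 : ℚ) =
        1 / (n : ℚ) * (Nat.choose (2 * n - 2) (n - 1) : ℚ)) ∧
    (∀ i : ℕ, 1 ≤ i → i + 2 ≤ n →
      DiagQSym.hilbertMatrix n i 2 =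
        ∑ j ∈ Finset.Icc 1 i, ∑ k ∈ Finset.Icc 1 2, DiagQSym.hilbertMatrix (n - 1) j k) ∧
    (∀ i : ℕ, n ≤ i → DiagQSym.hilbertMatrix n i 2 = 0) ∧
    -- the symmetry of the Hilbert matrix
    (∀ a b : ℕ, 1 ≤ a → 1 ≤ b →
      DiagQSym.hilbertMatrix n a b = DiagQSym.hilbertMatrix n b a) ∧
    -- the second row
    (2 ≤ n →
      (DiagQSym.hilbertMatrix n 2 (n - 1) : ℚ) =
        1 / (n : ℚ) * (Nat.choose (2 * n - 2) (n - 1) : ℚ)) ∧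
    (∀ i : ℕ, 1 ≤ i → i + 2 ≤ n →
      DiagQSym.hilbertMatrix n 2 i =
        ∑ j ∈ Finset.Icc 1 i, ∑ k ∈ Finset.Icc 1 2, DiagQSym.hilbertMatrix (n - 1) k j) ∧
    (∀ i : ℕ, n ≤ i → DiagQSym.hilbertMatrix n 2 i = 0) := by
  refine ⟨DiagQSym.hilbertMatrix_column_two_top,
    fun i => DiagQSym.hilbertMatrix_column_two_eq_sum,
    fun i => DiagQSym.hilbertMatrix_column_two_eq_zero hn,
    fun a b _ _ => DiagQSym.hilbertMatrix_comm n a b, fun h => ?_, fun i h h' => ?_, fun i h => ?_⟩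
  · rw [DiagQSym.hilbertMatrix_comm]
    exact DiagQSym.hilbertMatrix_column_two_top h
  · rw [DiagQSym.hilbertMatrix_comm, DiagQSym.hilbertMatrix_column_two_eq_sum h h']
    exact Finset.sum_congr rfl fun j _ => Finset.sum_congr rfl fun k _ =>
      DiagQSym.hilbertMatrix_comm _ _ _
  · rw [DiagQSym.hilbertMatrix_comm]
    exact DiagQSym.hilbertMatrix_column_two_eq_zero hn h
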